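/- Let $R$ be a commutative ring, regarded as a discrete topological ring. Let $\mathsf{Tate}_{\aleph_0,R}$ be the category of countable Tate objects in the category $\mathsf{Proj}^{\mathrm{fg}}_R$ of finitely generated projective $R$-modules. That is, it is the idempotent completion of the category of countable elementary Tate objects: admissible ind-objects $\text{"}\mathrm{colim}_i\text{"}\,X_i$, indexed by countable directed posets, of countable admissible pro-objects $X_i$ of $\mathsf{Proj}^{\mathrm{fg}}_R$, such that for $i\le j$ the transition map $X_i\to X_j$ is an admissible monomorphism with quotient $X_j/X_i$ in $\mathsf{Proj}^{\mathrm{fg}}_R$. Let $\tau$ be the functor from $\mathsf{Tate}_{\aleph_0,R}$ to linearly topologized $R$-modules that realizes formal limits and colimits as actual ones (finitely generated projective modules being discrete), and let $\mathsf{TC}_R(T)=C^0(-,\tau(T))$ be the associated condensed $R$-module. Let $\mathsf{Solid}_R$ be the full subcategory of condensed $R$-modules consisting of those $M$ for which the canonical map $\mathrm{Hom}_R(R_\blacksquare[S],M)\to M(S)$ is bijective for every extremally disconnected profinite set $S$. Here, for $S=\lim_i S_i$ with $S_i$ finite, $R_\blacksquare[S]=\mathrm{colim}_{R'\subseteq R}\lim_i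 R'[S_i]$, the colimit running over the finitely generated subrings $R'$ of $R$. Then $\mathsf{TC}_R$ takes values in solid modules, so that it defines a functor $\mathsf{TS}_R\colon \mathsf{Tate}_{\aleph_0,R}\to\mathsf{Solid}_R$. The condensed $R$-module $R(\!(t)\!)$ of Laurent series with the $t$-adic topology is solid and is isomorphic to $R^{\mathbb N}\oplus R^{(\mathbb N)}=\prod_{\mathbb N}R\oplus\bigoplus_{\mathbb N}R$. A solid $R$-module $M$ lies in the essential image of $\mathsf{TS}_R$ if and only if $M$ is a direct summand of $R(\!(t)\!)$ in $\mathsf{Solid}_R$. -/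

import Mathlib

open CategoryTheory Limits Opposite Topology

universe u v

noncomputable section

/-! ### Linear topologies -/

/-- The linear topology on `M` generated by a set `B` of submodules: the coarsest topology for which
every quotient map `M → M ⧸ U`, with `U ∈ B` and `M ⧸ U` discrete, is continuous. If `B` is
nonempty and directed downwards, then the members of `B` are a basis of neighbourhoods of `0`. -/
abbrev linTopology {R : Type v} [CommRing R] {M : Type v} [AddCommGroup M] [Module R M]
    (B : Set (Submodule R M)) : TopologicalSpace M :=
  ⨅ U : B, TopologicalSpace.induced (U.1.mkQ) ⊥

theorem linTopology_isTopologicalAddGroup {R : Type v} [CommRing R] {M : Type v} [AddCommGroup M]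
    [Module R M] (B : Set (Submodule R M)) :
    @IsTopologicalAddGroup M (linTopology B) _ := by
  refine topologicalAddGroup_iInf fun U => ?_
  let _ : TopologicalSpace (M ⧸ U.1) := ⊥
  have : DiscreteTopology (M ⧸ U.1) := ⟨rfl⟩
  exact topologicalAddGroup_induced U.1.mkQ

theorem linTopology_continuousSMul {R : Type v} [CommRing R] [TopologicalSpace R]
    [DiscreteTopology R] {M : Type v} [AddCommGroup M] [Module R M] (B : Set (Submodule R M)) :
    @ContinuousSMul R M _ _ (linTopology B) := by
  refine continuousSMul_iInf fun U => ?_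
  let _ : TopologicalSpace (M ⧸ U.1) := ⊥
  have : DiscreteTopology (M ⧸ U.1) := ⟨rfl⟩
  have : ContinuousSMul R (M ⧸ U.1) := ⟨continuous_of_discreteTopology⟩
  exact continuousSMul_induced U.1.mkQ

/-- If the preimage of every `V ∈ B'` lies in `B`, then the map is continuous. -/
theorem linTopology_continuous {R : Type v} [CommRing R] {M N : Type v} [AddCommGroup M]
    [Module R M] [AddCommGroup N] [Module R N] (B : Set (Submodule R M))
    (B' : Set (Submodule R N)) (f : M →ₗ[R] N) (h : ∀ V ∈ B', V.comap f ∈ B) :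
    @Continuous M N (linTopology B) (linTopology B') f := by
  refine continuous_iInf_rng.2 fun V => continuous_induced_rng.2 ?_
  refine continuous_iInf_dom (i := ⟨V.1.comap f, h V.1 V.2⟩) ?_
  let _ : TopologicalSpace (M ⧸ V.1.comap f) := ⊥
  have : DiscreteTopology (M ⧸ V.1.comap f) := ⟨rfl⟩
  let _ : TopologicalSpace (N ⧸ V.1) := ⊥
  have h1 : V.1.mkQ ∘ f = (Submodule.mapQ (V.1.comap f) V.1 f le_rfl) ∘ (V.1.comap f).mkQ := by
    ext x
    simp
  rw [h1]
  exact @Continuous.comp _ _ _ (TopologicalSpace.induced _ ⊥) _ _ _ _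
    continuous_of_discreteTopology continuous_induced_dom

/-- The topological module given by a module and a set of submodules generating its topology. -/
def linTopModule {R : Type v} [CommRing R] [TopologicalSpace R] [DiscreteTopology R]
    (M : ModuleCat.{v} R) (B : Set (Submodule R M)) : TopModuleCat.{v} R where
  toModuleCat := M
  topologicalSpace := linTopology B
  isTopologicalAddGroup := linTopology_isTopologicalAddGroup B
  continuousSMul := linTopology_continuousSMul B

/-! ### Countable Tate objects in finitely generated projective modules

For an additive (here: `R`-linear) category `A`, ind-objects of `A` are modelled by filtered
colimits of representable functors in the category of `R`-module valued presheaves on `A`;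
pro-objects of `A` are modelled as the opposite of the category of ind-objects of `Aᵒᵖ`, that is,
by filtered colimits of corepresentable functors `A ⥤ ModuleCat R`, with arrows reversed. -/

/-- The category of finitely generated projective `R`-modules (a small skeleton-like model: the
objects are the projective modules of the form `Rⁿ ⧸ S`; morphisms are all linear maps). -/
abbrev ProjFG (R : Type v) [CommRing R] : Type v :=
  InducedCategory (ModuleCat.{v} R)
    fun P : {P : FGModuleRepr R // Module.Projective R P} => ModuleCat.of R P.1

/-- The small model contains every finitely generated projective module, up to isomorphism. -/
theorem ProjFG.exists_linearEquiv (R : Type v) [CommRing R] (M : Type*) [AddCommGroup M]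
    [Module R M] [Module.Finite R M] [Module.Projective R M] :
    ∃ P : ProjFG R, Nonempty (P.1 ≃ₗ[R] M) :=
  ⟨⟨FGModuleRepr.ofFinite R M, Module.Projective.of_equiv (FGModuleRepr.ofFiniteEquiv R M).symm⟩,
    ⟨FGModuleRepr.ofFiniteEquiv R M⟩⟩

/-- The free module of rank one, as an object of `ProjFG R`. -/
def ProjFG.unit (R : Type v) [CommRing R] : ProjFG R :=
  ⟨FGModuleRepr.ofFinite R R, Module.Projective.of_equiv (FGModuleRepr.ofFiniteEquiv R R).symm⟩

/-- `F : ProjFG R ⥤ ModuleCat R` is a countable admissible pro-object `"lim" P_i` of `ProjFG R`: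
the colimit of the functors `Hom(P_i, -)` for an inverse system `P` indexed by a countable directed
poset whose transition maps are admissible epimorphisms (surjections). -/
def IsAdmissiblePro (R : Type v) [CommRing R] : ObjectProperty (ProjFG R ⥤ ModuleCat.{v} R) :=
  fun F => ∃ (I : Type) (_ : PartialOrder I) (_ : Countable I) (_ : Nonempty I)
    (_ : IsDirectedOrder I) (P : I ⥤ (ProjFG R)ᵒᵖ)
    (c : Cocone (P ⋙ linearCoyoneda R (ProjFG R))),
    (∀ ⦃i j : I⦄ (f : i ⟶ j), Function.Surjective (P.map f).unop.hom) ∧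
      Nonempty (IsColimit c) ∧ Nonempty (c.pt ≅ F)

/-- The opposite of the category of countable admissible pro-objects of `ProjFG R`. -/
abbrev ProjProOp (R : Type v) [CommRing R] : Type (v + 1) := (IsAdmissiblePro R).FullSubcategory

/-- The category of countable admissible pro-objects of `ProjFG R`. -/
abbrev ProjPro (R : Type v) [CommRing R] : Type (v + 1) := (ProjProOp R)ᵒᵖ

theorem isAdmissiblePro_corepresentable {R : Type v} [CommRing R] (P : ProjFG R) :
    IsAdmissiblePro R ((linearCoyoneda R (ProjFG R)).obj (op P)) := by
  let D : PUnit.{1} ⥤ (ProjFG R)ᵒᵖ := (Functor.const _).obj (op P)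
  refine ⟨PUnit, inferInstance, inferInstance, inferInstance, inferInstance, D,
    { pt := (linearCoyoneda R (ProjFG R)).obj (op P)
      ι := { app := fun _ => 𝟙 _, naturality := ?_ } }, ?_, ⟨?_⟩, ⟨Iso.refl _⟩⟩
  · intro i j f
    simp [D]
  · intro i j f x
    exact ⟨x, rfl⟩
  · exact
      { desc := fun s => s.ι.app PUnit.unit
        fac := fun s j => by
          cases j
          exact Category.id_comp _
        uniq := fun s m hm => by
          rw [← hm PUnit.unit]
          exact (Category.id_comp _).symm }

/-- A finitely generated projective module as a constant pro-object. -/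
def ProjPro.const {R : Type v} [CommRing R] (P : ProjFG R) : ProjPro R :=
  op ⟨(linearCoyoneda R (ProjFG R)).obj (op P), isAdmissiblePro_corepresentable P⟩

/-- `f : X ⟶ Y` is an admissible monomorphism of pro-objects whose cokernel is a finitely generated
projective module `P`: there is a short exact sequence `X ⟶ Y ⟶ P` of pro-objects. Exactness is
that of the category of left exact functors on the (split exact) category `ProjFG R`, that is, the
sequence `0 ⟶ Hom(P, A) ⟶ Hom(Y, A) ⟶ Hom(X, A) ⟶ 0` is exact for every `A` in `ProjFG R`. -/
def IsAdmissibleMonoWithFGCokernel {R : Type v} [CommRing R] {X Y : ProjPro R} (f : X ⟶ Y) :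
    Prop :=
  ∃ (P : ProjFG R) (g : Y ⟶ ProjPro.const P), ∀ A : ProjFG R,
    Function.Injective (g.unop.hom.app A) ∧
      Function.Exact (g.unop.hom.app A) (f.unop.hom.app A) ∧
      Function.Surjective (f.unop.hom.app A)

/-- `T` is a countable elementary Tate object: an admissible ind-object `"colim" X_i` of pro-objects,
indexed by a countable directed poset, such that each `X_j / X_i` is a finitely generated projective
module. A presheaf on `ProjPro R` is a functor on `ProjProOp R`, and the presheaf represented by a
pro-object is `linearCoyoneda`. -/
def IsElementaryTate (R : Type v) [CommRing R] : ObjectProperty (ProjProOp R ⥤ ModuleCat.{v} R) :=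
  fun T => ∃ (I : Type) (_ : PartialOrder I) (_ : Countable I) (_ : Nonempty I)
    (_ : IsDirectedOrder I) (X : I ⥤ ProjPro R)
    (c : Cocone (X ⋙ linearCoyoneda R (ProjProOp R))),
    (∀ ⦃i j : I⦄ (f : i ⟶ j), IsAdmissibleMonoWithFGCokernel (X.map f)) ∧
      Nonempty (IsColimit c) ∧ Nonempty (c.pt ≅ T)

/-- The category of countable Tate `R`-modules: the idempotent completion of the category of
countable elementary Tate objects, realized as the category of retracts of elementary Tate objects
in the (idempotent complete) category of presheaves on pro-objects. -/
abbrev TateCat (R : Type v) [CommRing R] : Type (v + 1) :=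
  ObjectProperty.FullSubcategory fun T : ProjProOp R ⥤ ModuleCat.{v} R =>
    ∃ E, IsElementaryTate R E ∧ Nonempty (Retract T E)

/-! ### Topological realization -/

/-- The underlying module of the realization `lim P_i` of a pro-object `X = "lim" P_i` is
`Hom(R, X)` (an arrow from `X.unop` to the opposite of `R`). Its limit topology is the linear topology generated by the kernels of the maps
`Hom(R, X) ⟶ Hom(R, P)` induced by the morphisms from `X` to finitely generated projective modules
`P`. -/
abbrev proTopology {R : Type v} [CommRing R] (X : ProjPro R) :
    TopologicalSpace (X.unop ⟶ (ProjPro.const (ProjFG.unit R)).unop) :=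
  linTopology {U : Submodule R (X.unop ⟶ (ProjPro.const (ProjFG.unit R)).unop) |
    ∃ (P : ProjFG R) (q : X ⟶ ProjPro.const P),
      U = LinearMap.ker (Linear.leftComp R (ProjPro.const (ProjFG.unit R)).unop q.unop)}

/-- The submodules of `T(R)` which are open in the realization of `T`: those whose preimage in the
realization of `X` is open, for all pro-objects `X` and all morphisms `X ⟶ T` (that is, elements of
`T(X)`). -/
def realizationBasis {R : Type v} [CommRing R] (T : ProjProOp R ⥤ ModuleCat.{v} R) :
    Set (Submodule R (T.obj (ProjPro.const (ProjFG.unit R)).unop)) :=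
  {U | ∀ (X : ProjPro R) (x : T.obj X.unop),
    IsOpen[proTopology X]
      {h : X.unop ⟶ (ProjPro.const (ProjFG.unit R)).unop | T.map h x ∈ U}}

/-- The realization functor: formal limits and colimits become limits and colimits in linearly
topologized modules. The underlying module of `T = "colim" X_i` is `T(R) = colim Hom(R, X_i)`; its
topology is the colimit topology, i.e. the finest linear topology such that all maps from
realizations of pro-objects are continuous. -/
def tateRealization (R : Type v) [CommRing R] [TopologicalSpace R] [DiscreteTopology R] :
    (ProjProOp R ⥤ ModuleCat.{v} R) ⥤ TopModuleCat.{v} R where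
  obj T := linTopModule (T.obj (ProjPro.const (ProjFG.unit R)).unop) (realizationBasis T)
  map {T T'} φ := ConcreteCategory.ofHom (C := TopModuleCat.{v} R)
    { toLinearMap := (φ.app (ProjPro.const (ProjFG.unit R)).unop).hom
      cont := linTopology_continuous _ _ _ fun V hV X x => by
        convert! hV X (φ.app X.unop x) using 3 with h
        rw [← NatTrans.naturality_apply φ]
        exact Iff.rfl }
  map_id _ := by ext; rfl
  map_comp _ _ := by ext; rfl

/-! ### Condensed modules -/

/-- The condensed `R`-module `S ↦ C(S, M)` of a topological `R`-module `M`. -/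
def TopModuleCat.toCondensed (R : Type (u + 1)) [CommRing R] [TopologicalSpace R] :
    TopModuleCat.{u + 1} R ⥤ CondensedMod.{u} R where
  obj M :=
    { obj :=
        { obj := fun S => ModuleCat.of R C(S.unop, M)
          map := fun f => ModuleCat.ofHom
            { toFun := fun g => g.comp f.unop.hom.hom
              map_add' := fun _ _ => rfl
              map_smul' := fun _ _ => rfl } }
      property := by
        apply Presheaf.isSheaf_coherent_of_hasPullbacks_of_comp
          (s := CategoryTheory.forget (ModuleCat R))
        exact (topCatToCondensedSet.{u}.obj (TopCat.of M)).property }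
  map {M N} φ := ObjectProperty.homMk
    { app := fun S => ModuleCat.ofHom
        { toFun := fun g => ContinuousMap.comp ⟨φ.hom, φ.hom.continuous⟩ g
          map_add' := fun _ _ => by ext; simp
          map_smul' := fun _ _ => by ext; simp } }

/-- The functor from countable Tate modules to condensed modules. -/
def tateToCondensed (R : Type (u + 1)) [CommRing R] [TopologicalSpace R] [DiscreteTopology R] :
    TateCat R ⥤ CondensedMod.{u} R :=
  ObjectProperty.ι _ ⋙ tateRealization R ⋙ TopModuleCat.toCondensed.{u} R

/-! ### Solid modules -/

/-- For `S = lim S_i` over the finite discrete quotients `S_i` of `S`, the `R`-module of sections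
over `T` of the union over all finitely generated subrings `A ⊆ R` of `lim A[S_i]`: compatible
families of locally constant functions `T → R[S_i]`, all of whose coefficients lie in a common
finitely generated subring of `R`. -/
def solidSections (R : Type (u + 1)) [CommRing R] (S T : CompHaus.{u}) :
    Submodule R (∀ i : DiscreteQuotient S, LocallyConstant T (i →₀ R)) where
  carrier := {x | (∀ (i j : DiscreteQuotient S) (hij : i ≤ j) (t : T),
      Finsupp.mapDomain (DiscreteQuotient.ofLE hij) (x i t) = x j t) ∧
    ∃ s : Finset R, ∀ (i : DiscreteQuotient S) (t : T) (a : i),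
      x i t a ∈ Subring.closure (s : Set R)}
  zero_mem' := ⟨fun i j hij t => by simp, ∅, fun i t a => by simp⟩
  add_mem' := by
    classical
    rintro x y ⟨hx, s, hs⟩ ⟨hy, s', hs'⟩
    refine ⟨fun i j hij t => ?_, s ∪ s', fun i t a => ?_⟩
    · simp [Finsupp.mapDomain_add, hx i j hij t, hy i j hij t]
    · simp only [Pi.add_apply, LocallyConstant.coe_add, Finsupp.coe_add]
      exact add_mem (Subring.closure_mono (by simp) (hs i t a))
        (Subring.closure_mono (by simp) (hs' i t a))
  smul_mem' := by
    classical
    rintro r x ⟨hx, s, hs⟩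
    refine ⟨fun i j hij t => ?_, insert r s, fun i t a => ?_⟩
    · simp [Finsupp.mapDomain_smul, hx i j hij t]
    · simp only [Pi.smul_apply, LocallyConstant.coe_smul, Finsupp.coe_smul, smul_eq_mul]
      exact mul_mem (Subring.subset_closure (by simp))
        (Subring.closure_mono (by simp) (hs i t a))

/-- The presheaf `T ↦ colim_A lim_i A[S_i](T)` of `R`-modules. -/
def solidPresheaf (R : Type (u + 1)) [CommRing R] (S : CompHaus.{u}) :
    CompHaus.{u}ᵒᵖ ⥤ ModuleCat.{u + 1} R where
  obj T := ModuleCat.of R (solidSections R S T.unop)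
  map f := ModuleCat.ofHom
    { toFun := fun x => ⟨fun i => (x.1 i).comap f.unop.hom.hom,
        fun i j hij t => x.2.1 i j hij _, x.2.2.imp fun s hs i t a => hs i _ a⟩
      map_add' := fun _ _ => rfl
      map_smul' := fun _ _ => rfl }

/-- The condensed `R`-module `R_■[S] = colim_A lim_i A[S_i]` of measures on `S`; the colimit, over
the finitely generated subrings `A` of `R`, is taken in sheaves. -/
def solidFree (R : Type (u + 1)) [CommRing R] (S : CompHaus.{u}) : CondensedMod.{u} R :=
  (presheafToSheaf (coherentTopology CompHaus.{u}) (ModuleCat.{u + 1} R)).obj (solidPresheaf R S)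

/-- The family of Dirac measures `s ↦ ([s]_i)_i`. -/
def diracSection (R : Type (u + 1)) [CommRing R] (S : CompHaus.{u}) : solidSections R S S :=
  ⟨fun i => (⟨i.proj, i.proj_isLocallyConstant⟩ : LocallyConstant S i).map
      fun a => Finsupp.single a 1, by
    classical
    refine ⟨fun i j hij t => ?_, ∅, fun i t a => ?_⟩
    · simp [Finsupp.mapDomain_single]
    · simp only [LocallyConstant.map_apply, Function.comp_apply, Finsupp.single_apply]
      split_ifs
      · exact one_mem _
      · exact zero_mem _⟩

/-- The universal section of `R_■[S]` over `S`, i.e. the canonical map `S ⟶ R_■[S]`. -/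
def solidDirac (R : Type (u + 1)) [CommRing R] (S : CompHaus.{u}) :
    (solidFree R S).obj.obj (op S) :=
  (toSheafify (coherentTopology CompHaus.{u}) (solidPresheaf R S)).app (op S) (diracSection R S)

/-- A condensed `R`-module `M` is solid if `Hom(R_■[S], M) ⟶ Hom(S, M) = M(S)` is bijective for all
extremally disconnected `S`. -/
def IsSolidMod (R : Type (u + 1)) [CommRing R] : ObjectProperty (CondensedMod.{u} R) :=
  fun M => ∀ S : Stonean.{u},
    Function.Bijective fun f : solidFree R (Stonean.toCompHaus.obj S) ⟶ M =>
      f.hom.app (op (Stonean.toCompHaus.obj S)) (solidDirac R (Stonean.toCompHaus.obj S))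

/-- The category of solid `R`-modules. -/
abbrev SolidMod (R : Type (u + 1)) [CommRing R] : Type (u + 2) := (IsSolidMod.{u} R).FullSubcategory

/-- The functor from countable Tate modules to solid modules, given that the condensed modules
attached to Tate modules are solid. -/
def tateToSolid (R : Type (u + 1)) [CommRing R] [TopologicalSpace R] [DiscreteTopology R]
    (h : ∀ T : TateCat R, IsSolidMod.{u} R ((tateToCondensed.{u} R).obj T)) :
    TateCat R ⥤ SolidMod.{u} R :=
  (IsSolidMod.{u} R).lift (tateToCondensed.{u} R) h

/-! ### Laurent series and direct summands -/

/-- The ring of Laurent series over `R` with its `t`-adic topology, as a topological module: the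
submodules `tⁿ R⟦t⟧`, for `n ∈ ℤ`, are a basis of neighbourhoods of `0`. -/
def laurentTop (R : Type v) [CommRing R] [TopologicalSpace R] [DiscreteTopology R] :
    TopModuleCat.{v} R :=
  linTopModule (ModuleCat.of R (LaurentSeries R))
    {U | ∃ n : ℤ, ∀ f : LaurentSeries R, f ∈ U ↔ ∀ k < n, f.coeff k = 0}

/-- The condensed `R`-module `R((t))`. -/
def laurentCondensed (R : Type (u + 1)) [CommRing R] [TopologicalSpace R] [DiscreteTopology R] :
    CondensedMod.{u} R :=
  (TopModuleCat.toCondensed.{u} R).obj (laurentTop R)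

/-- The condensed `R`-module `R` (the constant sheaf). -/
def unitCondensed (R : Type (u + 1)) [CommRing R] : CondensedMod.{u} R :=
  (Condensed.discrete.{u} (ModuleCat.{u + 1} R)).obj (ModuleCat.of R R)

/-- `X` is a direct summand of `Y`: there is an object `Z` such that `Y` is a biproduct of `X` and
`Z`. -/
def IsDirectSummand {A : Type*} [Category A] [HasZeroMorphisms A] (X Y : A) : Prop :=
  ∃ (Z : A) (b : BinaryBicone X Z), Nonempty b.IsBilimit ∧ Nonempty (b.pt ≅ Y)

end

/-! The whole statement is controlled by one object, the Tate object `laurentTate R`, whose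
realization is `R((t))`.

A functor in `ProjProOp R` is linear, and every finitely generated projective module is a retract of
some `Rⁿ`; so morphisms between such functors are the same as linear maps between their values at
`R`. For a pro-object `X` this value is the dual `D = Hom(X, R)`. If `X` is countable with
surjective transition maps, then `D` is an increasing union of split inclusions of finitely
generated projective modules, hence projective and countably generated
(`IsAdmissiblePro.exists_dual_basis`).

Every elementary Tate object is a retract of `R((t))` (`IsElementaryTate.nonempty_retract`). Along a
cofinal sequence of pro-objects the duals form a tower of surjections `D (n+1) → D n` with finitely
generated kernels. A dual basis of `D n`, indexed by integers bounded below, extends to one of `D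
(n+1)` by adding finitely many vectors in fresh negative degrees (`IsDualBasis.exists_lift`). The
vectors of these bases define a map to `R((t))`, and their coordinate functions define a map back.

`R((t))` is solid (`isSolidMod_laurentCondensed`). Coefficientwise, this says that a linear form on
measures on `S` that is locally constant in families is integration of a locally constant function.
By Nöbeling's theorem `C(S, ℤ)` is free, so measures with coefficients in a subring `A` are
arbitrary functions from a basis to `A`; restricting such a function to subsets of the basis gives a
family over a Cantor cube, on which local constancy means dependence on finitely many coordinates
near a point. Solidity passes to retracts, hence to all realizations of Tate objects.

Conversely, `R((t))` is first countable, so endomorphisms of the condensed module are continuous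
linear maps (`TopModuleCat.exists_toCondensed_map_eq`), and these are matrices that lift to the Tate
object (`exists_laurentTate_hom`). Idempotents therefore lift and split among Tate objects. As solid
modules are idempotent complete, retracts and direct summands agree. The decomposition of `R((t))`
separates nonnegative from negative degrees. -/

noncomputable section

/-! ### Linear functors on finitely generated projective modules -/

section

namespace ProjFG

variable {R : Type v} [CommRing R]

/-- A linear map, as a morphism of `ProjFG R`. -/
def ofLinear {A B : ProjFG R} (f : A.1 →ₗ[R] B.1) : A ⟶ B := ⟨ModuleCat.ofHom f⟩

theorem ofLinear_apply {A B : ProjFG R} (f : A.1 →ₗ[R] B.1) (x : A.1) :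
    (ofLinear f).hom x = f x := rfl

theorem hom_ext_apply {A B : ProjFG R} {f g : A ⟶ B} (h : ∀ x : A.1, f.hom x = g.hom x) : f = g :=
  InducedCategory.hom_ext (ModuleCat.hom_ext (LinearMap.ext h))

theorem comp_apply {A B C : ProjFG R} (f : A ⟶ B) (g : B ⟶ C) (x : A.1) :
    (f ≫ g).hom x = g.hom (f.hom x) := rfl

theorem smul_apply {A B : ProjFG R} (r : R) (f : A ⟶ B) (x : A.1) :
    (r • f).hom x = r • f.hom x := rfl

theorem add_apply {A B : ProjFG R} (f g : A ⟶ B) (x : A.1) :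
    (f + g).hom x = f.hom x + g.hom x := rfl

theorem id_apply {A : ProjFG R} (x : A.1) : (𝟙 A : A ⟶ A).hom x = x := rfl

theorem sum_apply {A B : ProjFG R} {ι : Type*} (s : Finset ι) (f : ι → (A ⟶ B)) (x : A.1) :
    (∑ i ∈ s, f i).hom x = ∑ i ∈ s, (f i).hom x := by
  classical
  induction s using Finset.induction_on with
  | empty => simp only [Finset.sum_empty]; rfl
  | insert i s hi ih => rw [Finset.sum_insert hi, Finset.sum_insert hi, add_apply, ih]

variable (R) in
/-- The identification of the underlying module of the unit with `R`. -/
def unitEquiv : (unit R).1 ≃ₗ[R] R := FGModuleRepr.ofFiniteEquiv R R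

/-- The generator of the unit. -/
def one : (unit R).1 := (unitEquiv R).symm 1

/-- The morphism from the unit given by an element. -/
def ofElement {A : ProjFG R} : A.1 →ₗ[R] (unit R ⟶ A) where
  toFun a := ofLinear ((LinearMap.toSpanSingleton R A.1 a).comp (unitEquiv R).toLinearMap)
  map_add' a b := hom_ext_apply fun x => by
    exact smul_add (unitEquiv R x) a b
  map_smul' r a := hom_ext_apply fun x => by
    exact smul_comm (unitEquiv R x) r a

/-- The morphism to the unit given by a linear form. -/
def ofDual {A : ProjFG R} (α : A.1 →ₗ[R] R) : A ⟶ unit R :=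
  ofLinear ((unitEquiv R).symm.toLinearMap.comp α)

theorem ofElement_apply {A : ProjFG R} (a : A.1) (x : (unit R).1) :
    (ofElement a).hom x = unitEquiv R x • a := rfl

theorem ofElement_one {A : ProjFG R} (a : A.1) : (ofElement a).hom (one : (unit R).1) = a := by
  rw [ofElement_apply]; simp [one]

theorem ofDual_apply {A : ProjFG R} (α : A.1 →ₗ[R] R) (x : A.1) :
    (ofDual α).hom x = (unitEquiv R).symm (α x) := rfl

theorem ofDual_comp_ofElement_apply {A B : ProjFG R} (α : A.1 →ₗ[R] R) (b : B.1) (x : A.1) :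
    (ofDual α ≫ ofElement b).hom x = α x • b := by
  rw [comp_apply, ofDual_apply, ofElement_apply, LinearEquiv.apply_symm_apply]

theorem hom_unit_ext {A : ProjFG R} {f g : unit R ⟶ A}
    (h : f.hom (one : (unit R).1) = g.hom (one : (unit R).1)) : f = g := by
  refine hom_ext_apply fun x => ?_
  have hx : x = unitEquiv R x • one := by
    apply (unitEquiv R).injective
    simp [one]
  have key : ∀ k : unit R ⟶ A, k.hom x = unitEquiv R x • k.hom one := fun k => by
    conv_lhs => rw [hx]
    exact k.hom.hom.map_smul _ _
  rw [key f, key g, h]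

theorem ofElement_eq {A : ProjFG R} (f : unit R ⟶ A) : ofElement (f.hom one) = f :=
  hom_unit_ext (ofElement_one _)

theorem ofElement_comp {A B : ProjFG R} (a : A.1) (f : A ⟶ B) :
    ofElement a ≫ f = ofElement (f.hom a) :=
  hom_unit_ext (by rw [comp_apply, ofElement_one, ofElement_one])

/-- Evaluation at the generator. -/
def homUnitEquiv (A : ProjFG R) : (unit R ⟶ A) ≃ₗ[R] A.1 :=
  LinearEquiv.symm
  { ofElement with
    invFun := fun f => f.hom one
    left_inv := fun a => ofElement_one a
    right_inv := fun f => ofElement_eq f }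

variable (R) in
/-- Endomorphisms of the unit are scalars. -/
def endUnitEquiv : (unit R ⟶ unit R) ≃ₗ[R] R := (homUnitEquiv _).trans (unitEquiv R)

theorem endUnitEquiv_smul_id (f : unit R ⟶ unit R) : endUnitEquiv R f • 𝟙 (unit R) = f := by
  refine hom_unit_ext ?_
  rw [smul_apply, id_apply]
  apply (unitEquiv R).injective
  rw [map_smul]
  simp [one, endUnitEquiv, homUnitEquiv]

/-- A projective module with `n` generators is a retract of `Rⁿ`. Written this way, the identity
becomes a sum of morphisms factoring through the unit, which any additive functor respects. -/
theorem exists_dual_basis (A : ProjFG R) :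
    ∃ (n : ℕ) (a : Fin n → A.1) (α : Fin n → (A.1 →ₗ[R] R)),
      ∑ i, ofDual (α i) ≫ ofElement (a i) = 𝟙 A := by
  have : Module.Projective R A.1 := A.2
  obtain ⟨n, f, g, -, -, h⟩ := Module.Finite.exists_comp_eq_id_of_projective R A.1
  refine ⟨n, fun i => f (Pi.single i 1), fun i => (LinearMap.proj i).comp g, ?_⟩
  refine hom_ext_apply fun x => ?_
  rw [sum_apply]
  have hx : x = ∑ i, f (Pi.single i (g x i)) := by
    conv_lhs => rw [← LinearMap.id_apply (R := R) x, ← h, LinearMap.comp_apply,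
      ← Finset.univ_sum_single (g x)]
    rw [map_sum]
  refine Eq.trans ?_ hx.symm
  refine Finset.sum_congr rfl fun i _ => (ofDual_comp_ofElement_apply _ _ _).trans ?_
  rw [← map_smul]
  congr 1
  ext j
  simp [Pi.single_apply]

end ProjFG

section LinearFunctors

open ProjFG

variable {R : Type v} [CommRing R] {F G H : ProjFG R ⥤ ModuleCat.{v} R}

theorem map_sum_apply [F.Additive] {A B : ProjFG R} {n : ℕ} (f : Fin n → (A ⟶ B)) (x : F.obj A) :
    F.map (∑ i, f i) x = ∑ i, F.map (f i) x := by
  rw [F.map_sum]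
  change (∑ i, F.map (f i)).hom x = _
  rw [ModuleCat.hom_sum]
  exact LinearMap.sum_apply _ _ _

theorem map_comp_apply' {A B C : ProjFG R} (f : A ⟶ B) (g : B ⟶ C) (x : F.obj A) :
    F.map (f ≫ g) x = F.map g (F.map f x) := by
  rw [F.map_comp]; rfl

theorem map_id_apply' {A : ProjFG R} (x : F.obj A) : F.map (𝟙 A) x = x := by
  rw [F.map_id]; rfl

theorem map_smul_id_apply [F.Additive] [F.Linear R] {A : ProjFG R} (r : R) (x : F.obj A) :
    F.map (r • 𝟙 A) x = r • x := by
  rw [F.map_smul, F.map_id]; rfl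

theorem map_end_apply [F.Additive] [F.Linear R] (f : unit R ⟶ unit R) (x : F.obj (unit R)) :
    F.map f x = endUnitEquiv R f • x := by
  conv_lhs => rw [← endUnitEquiv_smul_id f]
  exact map_smul_id_apply _ _

theorem eq_sum_of_dual_basis [F.Additive] {A : ProjFG R} {n : ℕ} {a : Fin n → A.1}
    {α : Fin n → (A.1 →ₗ[R] R)} (h : ∑ i, ofDual (α i) ≫ ofElement (a i) = 𝟙 A) (x : F.obj A) :
    x = ∑ i, F.map (ofElement (a i)) (F.map (ofDual (α i)) x) := by
  conv_lhs => rw [← map_id_apply' (F := F) x, ← h, map_sum_apply]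
  simp only [map_comp_apply']

theorem nat_apply (φ : F ⟶ G) {A B : ProjFG R} (f : A ⟶ B) (x : F.obj A) :
    φ.app B (F.map f x) = G.map f (φ.app A x) :=
  NatTrans.naturality_apply φ f x

/-- A natural transformation of linear functors is determined by its value at the unit. -/
theorem natTrans_ext_unit [F.Additive] {φ ψ : F ⟶ G}
    (h : ∀ x, φ.app (unit R) x = ψ.app (unit R) x) : φ = ψ := by
  ext A x
  obtain ⟨n, a, α, hA⟩ := exists_dual_basis A
  change φ.app A x = ψ.app A x
  rw [eq_sum_of_dual_basis hA x, map_sum, map_sum]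
  refine Finset.sum_congr rfl fun i _ => ?_
  rw [nat_apply φ, nat_apply φ, nat_apply ψ, nat_apply ψ, ← nat_apply φ, h, nat_apply ψ]

/-- The value at `A` is forced by a dual basis of `A`. One basis is chosen for each `A`; naturality
shows at the same time that the choice is immaterial. -/
theorem exists_natTrans_of_unit [F.Additive] [F.Linear R] [G.Additive] [G.Linear R]
    (D : F.obj (unit R) →ₗ[R] G.obj (unit R)) :
    ∃ φ : F ⟶ G, ∀ x, φ.app (unit R) x = D x := by
  choose n a α h using exists_dual_basis (R := R)
  let Φ (A : ProjFG R) : F.obj A →ₗ[R] G.obj A :=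
    ∑ i, (G.map (ofElement (a A i))).hom ∘ₗ D ∘ₗ (F.map (ofDual (α A i))).hom
  have hΦ (A : ProjFG R) (x : F.obj A) : Φ A x =
      ∑ i, G.map (ofElement (a A i)) (D (F.map (ofDual (α A i)) x)) :=
    LinearMap.sum_apply _ _ _
  have key {A B : ProjFG R} (f : A ⟶ B) (x : F.obj A) : Φ B (F.map f x) = G.map f (Φ A x) := by
    rw [hΦ, hΦ, map_sum]
    -- `ofElement ≫ f ≫ ofDual` is an endomorphism of the unit, hence a scalar, and `D` commutes
    -- with scalars.
    have h1 (j) : D (F.map (ofDual (α B j)) (F.map f x)) =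
        ∑ i, G.map (ofElement (a A i) ≫ f ≫ ofDual (α B j)) (D (F.map (ofDual (α A i)) x)) := by
      conv_lhs => rw [← map_comp_apply', eq_sum_of_dual_basis (h A) x, map_sum, map_sum]
      refine Finset.sum_congr rfl fun i _ => ?_
      rw [← map_comp_apply', map_end_apply, map_end_apply, map_smul]
    simp only [h1, map_sum]
    rw [Finset.sum_comm]
    refine Finset.sum_congr rfl fun i _ => ?_
    simp only [← map_comp_apply', Category.assoc]
    rw [← map_sum_apply, ← Preadditive.comp_sum, ← Preadditive.comp_sum, h B, Category.comp_id]
  refine ⟨{ app := fun A => ModuleCat.ofHom (Φ A), naturality := fun A B f => ?_ }, fun x => ?_⟩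
  · ext x
    exact key f x
  · change Φ _ x = D x
    conv_rhs => rw [eq_sum_of_dual_basis (h (unit R)) x, map_sum]
    rw [hΦ]
    refine Finset.sum_congr rfl fun i _ => ?_
    rw [map_end_apply, map_end_apply, map_end_apply, map_smul, map_smul, map_smul]

/-- The natural transformation of linear functors with given value at the unit. -/
def natTransOfUnit [F.Additive] [F.Linear R] [G.Additive] [G.Linear R]
    (D : F.obj (unit R) →ₗ[R] G.obj (unit R)) : F ⟶ G :=
  (exists_natTrans_of_unit D).choose

theorem natTransOfUnit_app [F.Additive] [F.Linear R] [G.Additive] [G.Linear R]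
    (D : F.obj (unit R) →ₗ[R] G.obj (unit R)) (x : F.obj (unit R)) :
    (natTransOfUnit D).app (unit R) x = D x :=
  (exists_natTrans_of_unit D).choose_spec x

end LinearFunctors

end

/-! ### Duals of countable pro-objects -/

section

section FilteredColimits

variable {R : Type v} [CommRing R] {K : Type*} [Category K] {J : Type} [SmallCategory J]
  [IsFiltered J]

instance preservesFilteredColimits_forget_moduleCat :
    PreservesFilteredColimitsOfSize.{0, 0} (forget (ModuleCat.{v} R)) :=
  preservesFilteredColimitsOfSize_shrink.{0, v, 0, v} _

instance reflectsColimitsOfShape_forget_moduleCat :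
    ReflectsColimitsOfShape J (forget (ModuleCat.{v} R)) :=
  reflectsColimitsOfShape_of_reflectsIsomorphisms

theorem colimit_jointly_surjective {D : J ⥤ K ⥤ ModuleCat.{v} R} {c : Cocone D}
    (hc : IsColimit c) (k : K) (x : c.pt.obj k) :
    ∃ (j : J) (y : (D.obj j).obj k), (c.ι.app j).app k y = x := by
  exact Concrete.isColimit_exists_rep _
    (isColimitOfPreserves ((evaluation K (ModuleCat.{v} R)).obj k) hc) x

/-- Filtered colimits of modules are computed on underlying sets. Since all legs are injective, two
elements with the same image already agree at any common later stage. -/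
theorem nonempty_isColimit_of_jointly_bijective {D : J ⥤ K ⥤ ModuleCat.{v} R} {c : Cocone D}
    (hs : ∀ (k : K) (x : c.pt.obj k), ∃ (j : J) (y : (D.obj j).obj k), (c.ι.app j).app k y = x)
    (hi : ∀ (j : J) (k : K), Function.Injective ((c.ι.app j).app k)) :
    Nonempty (IsColimit c) := by
  refine ⟨evaluationJointlyReflectsColimits _ fun k => ?_⟩
  refine isColimitOfReflects (forget (ModuleCat.{v} R)) ?_
  refine Types.FilteredColimit.isColimitOf _ _ (fun x => ?_) fun i j x y h => ?_
  · obtain ⟨j, y, h⟩ := hs k x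
    exact ⟨j, y, h.symm⟩
  · refine ⟨IsFiltered.max i j, IsFiltered.leftToMax i j, IsFiltered.rightToMax i j, ?_⟩
    apply hi (IsFiltered.max i j) k
    have h1 := fun z => congrArg (fun f => (f.app k) z) (c.w (IsFiltered.leftToMax i j))
    have h2 := fun z => congrArg (fun f => (f.app k) z) (c.w (IsFiltered.rightToMax i j))
    exact (h1 x).trans (h.trans (h2 y).symm)

end FilteredColimits

section AdmissiblePro

open ProjFG

variable {R : Type v} [CommRing R]

/-- Linearity is not part of the definition of a pro-object. It holds because each element comes
from a corepresentable functor, where it is bilinearity of composition. -/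
theorem IsAdmissiblePro.map_smul_add {F : ProjFG R ⥤ ModuleCat.{v} R} (hF : IsAdmissiblePro R F)
    {A B : ProjFG R} (f g : A ⟶ B) (r : R) : F.map (r • f + g) = r • F.map f + F.map g := by
  obtain ⟨I, _, _, _, _, P, c, -, ⟨hc⟩, ⟨e⟩⟩ := hF
  ext x
  obtain ⟨i, y, hy⟩ := colimit_jointly_surjective hc A ((e.inv.app A) x)
  have hx : x = ((c.ι.app i) ≫ e.hom).app A y := by
    change x = e.hom.app A ((c.ι.app i).app A y)
    rw [hy]
    change x = (e.inv.app A ≫ e.hom.app A) x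
    simp
  generalize c.ι.app i ≫ e.hom = φ at hx
  subst hx
  change F.map (r • f + g) (φ.app A y) = r • F.map f (φ.app A y) + F.map g (φ.app A y)
  rw [← nat_apply φ, ← nat_apply φ, ← nat_apply φ, ← map_smul, ← map_add]
  congr 1

theorem IsAdmissiblePro.additive {F : ProjFG R ⥤ ModuleCat.{v} R} (hF : IsAdmissiblePro R F) :
    F.Additive where
  map_add {A B f g} := by simpa using hF.map_smul_add f g 1

theorem IsAdmissiblePro.linear {F : ProjFG R ⥤ ModuleCat.{v} R} (hF : IsAdmissiblePro R F) :
    F.Linear R where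
  map_smul {A B} f r := by
    have := hF.additive
    simpa using hF.map_smul_add f 0 r

instance (F : ProjProOp R) : F.obj.Additive := F.property.additive

instance (F : ProjProOp R) : F.obj.Linear R := F.property.linear

/-- Morphisms to the unit are linear forms. -/
def ProjFG.dualEquiv (A : ProjFG R) : (A.1 →ₗ[R] R) ≃ₗ[R] (A ⟶ unit R) where
  toFun := ofDual
  map_add' α β := hom_ext_apply fun x => map_add (unitEquiv R).symm (α x) (β x)
  map_smul' r α := hom_ext_apply fun x => map_smul (unitEquiv R).symm r (α x)
  invFun f := (unitEquiv R).toLinearMap.comp f.hom.hom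
  left_inv α := by
    ext x
    exact (unitEquiv R).apply_symm_apply _
  right_inv f := hom_ext_apply fun x => (unitEquiv R).symm_apply_apply _

instance (A : ProjFG R) : Module.Projective R (A ⟶ unit R) :=
  have : Module.Projective R A.1 := A.2
  Module.Projective.of_equiv A.dualEquiv

instance (A : ProjFG R) : Module.Finite R (A ⟶ unit R) :=
  have : Module.Projective R A.1 := A.2
  Module.Finite.equiv A.dualEquiv

/-- Here `D` plays the role of the union of the `M n`: lifting a union of split inclusions of
projectives is possible one complement at a time. With `i` induced by the identity of `D`, this
splits `p`. -/
theorem exists_compatible_lifts {D W : Type*} [AddCommGroup D] [Module R D] [AddCommGroup W]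
    [Module R W] {M : ℕ → Type*} [∀ n, AddCommGroup (M n)] [∀ n, Module R (M n)]
    [∀ n, Module.Projective R (M n)] (t : ∀ n, M n →ₗ[R] M (n + 1))
    (r : ∀ n, M (n + 1) →ₗ[R] M n) (hrt : ∀ n, r n ∘ₗ t n = LinearMap.id)
    (i : ∀ n, M n →ₗ[R] D) (hi : ∀ n, i (n + 1) ∘ₗ t n = i n)
    (p : W →ₗ[R] D) (hp : Function.Surjective p) :
    ∃ h : ∀ n, M n →ₗ[R] W, (∀ n, h (n + 1) ∘ₗ t n = h n) ∧ ∀ n, p ∘ₗ h n = i n := by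
  choose l hl using fun n => Module.projective_lifting_property p (i n) hp
  -- Keep the lift already constructed on the image of `t n`, and use an arbitrary lift on the
  -- complement cut out by the projection `id - t n ∘ r n`.
  let step (n : ℕ) (k : {k : M n →ₗ[R] W // p ∘ₗ k = i n}) :
      {k : M (n + 1) →ₗ[R] W // p ∘ₗ k = i (n + 1)} :=
    ⟨k.1 ∘ₗ r n + l (n + 1) ∘ₗ (LinearMap.id - t n ∘ₗ r n), by
      rw [LinearMap.comp_add, ← LinearMap.comp_assoc, ← LinearMap.comp_assoc, k.2, hl,
        LinearMap.comp_sub, ← LinearMap.comp_assoc, hi, LinearMap.comp_id]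
      abel⟩
  let h : ∀ n, {k : M n →ₗ[R] W // p ∘ₗ k = i n} := fun n =>
    Nat.rec ⟨l 0, hl 0⟩ step n
  refine ⟨fun n => (h n).1, fun n => ?_, fun n => (h n).2⟩
  change ((h n).1 ∘ₗ r n + l (n + 1) ∘ₗ (LinearMap.id - t n ∘ₗ r n)) ∘ₗ t n = _
  rw [LinearMap.add_comp, LinearMap.comp_assoc, LinearMap.comp_assoc, hrt, LinearMap.sub_comp,
    LinearMap.comp_assoc, hrt]
  simp

/-- The dual is the union of the duals of the finite stages. These are finitely generated, which
gives countably many generators, and the inclusions split, which gives a section of the resulting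
surjection from `R^{(ℕ)}`. -/
theorem IsAdmissiblePro.exists_dual_basis {F : ProjFG R ⥤ ModuleCat.{v} R}
    (hF : IsAdmissiblePro R F) :
    ∃ (p : (ℕ →₀ R) →ₗ[R] F.obj (unit R)) (s : F.obj (unit R) →ₗ[R] (ℕ →₀ R)),
      p ∘ₗ s = LinearMap.id := by
  obtain ⟨I, _, _, _, _, P, c, hP, ⟨hc⟩, ⟨e⟩⟩ := hF
  -- A countable directed poset contains a cofinal sequence, and restricting to it does not change
  -- the colimit.
  let Q := IsFiltered.sequentialFunctor I ⋙ P
  let c' : Cocone (Q ⋙ linearCoyoneda R (ProjFG R)) :=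
    c.whisker (IsFiltered.sequentialFunctor I)
  have hc' : IsColimit c' := (Functor.Final.isColimitWhiskerEquiv _ _).symm hc
  obtain ⟨e⟩ : Nonempty (c'.pt ≅ F) := ⟨e⟩
  clear_value c'
  have hQ ⦃i j : ℕ⦄ (f : i ⟶ j) : Function.Surjective (Q.map f).unop.hom := hP _
  clear_value Q
  let M (n : ℕ) : Type v := (Q.obj n).unop ⟶ unit R
  let t (n : ℕ) : M n →ₗ[R] M (n + 1) :=
    Linear.leftComp R (unit R) (Q.map (homOfLE (Nat.le_succ n))).unop
  have hs (n : ℕ) : ∃ σ : (Q.obj n).unop ⟶ (Q.obj (n + 1)).unop,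
      σ ≫ (Q.map (homOfLE (Nat.le_succ n))).unop = 𝟙 _ := by
    have : Module.Projective R (Q.obj n).unop.1 := (Q.obj n).unop.2
    obtain ⟨σ, hσ⟩ := Module.projective_lifting_property
      (Q.map (homOfLE (Nat.le_succ n))).unop.hom.hom LinearMap.id (hQ _)
    exact ⟨ofLinear σ, hom_ext_apply fun x => LinearMap.congr_fun hσ x⟩
  choose σ hσ using hs
  let r (n : ℕ) : M (n + 1) →ₗ[R] M n := Linear.leftComp R (unit R) (σ n)
  let i (n : ℕ) : M n →ₗ[R] c'.pt.obj (unit R) := ((c'.ι.app n).app (unit R)).hom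
  have hi_surj (x : c'.pt.obj (unit R)) : ∃ (n : ℕ) (y : M n), i n y = x :=
    colimit_jointly_surjective hc' (unit R) x
  have hit (n : ℕ) : i (n + 1) ∘ₗ t n = i n := by
    have := congrArg (fun f => (f.app (unit R)).hom) (c'.w (homOfLE (Nat.le_succ n)))
    exact this
  obtain ⟨g, hg⟩ : ∃ g : ℕ → c'.pt.obj (unit R), Submodule.span R (Set.range g) = ⊤ := by
    choose S hS using fun n => Module.Finite.fg_top (R := R) (M := M n)
    -- Zero is inserted so that the generating set is visibly nonempty and can be enumerated by a
    -- sequence.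
    have hcount : (insert 0 (⋃ n, i n '' (S n : Set (M n)))).Countable :=
      (Set.countable_iUnion fun n => ((S n).countable_toSet.image _)).insert _
    obtain ⟨g, hg⟩ := hcount.exists_eq_range (Set.insert_nonempty _ _)
    refine ⟨g, ?_⟩
    rw [← hg, eq_top_iff]
    rintro x -
    obtain ⟨n, y, rfl⟩ := hi_surj x
    have hy : y ∈ Submodule.span R (S n : Set (M n)) := by rw [hS]; trivial
    have := Submodule.mem_map_of_mem (f := i n) hy
    rw [Submodule.map_span] at this
    refine Submodule.span_mono ?_ this
    exact (Set.subset_iUnion (fun n => i n '' (S n : Set (M n))) n).trans (Set.subset_insert _ _)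
  let p : (ℕ →₀ R) →ₗ[R] c'.pt.obj (unit R) := Finsupp.linearCombination R g
  have hp : Function.Surjective p := by
    rw [← LinearMap.range_eq_top, ← hg]
    exact Finsupp.range_linearCombination R
  obtain ⟨h, hht, hpi⟩ := exists_compatible_lifts t r (fun n => by
    refine LinearMap.ext fun x => ?_
    change σ n ≫ (Q.map (homOfLE (Nat.le_succ n))).unop ≫ x = x
    rw [← Category.assoc, hσ, Category.id_comp]) i hit p hp
  let d : Cocone ((Q ⋙ linearCoyoneda R (ProjFG R)) ⋙
      (evaluation _ (ModuleCat.{v} R)).obj (unit R)) :=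
    { pt := ModuleCat.of R (ℕ →₀ R)
      ι := NatTrans.ofSequence (fun n => ModuleCat.ofHom (h n)) fun n => by
        ext x
        exact LinearMap.congr_fun (hht n) x }
  let hc'' := isColimitOfPreserves ((evaluation _ (ModuleCat.{v} R)).obj (unit R)) hc'
  let s : c'.pt.obj (unit R) →ₗ[R] (ℕ →₀ R) := (hc''.desc d).hom
  have hsi (n : ℕ) (y : M n) : s (i n y) = h n y :=
    congrArg (fun f => f.hom y) (hc''.fac d n)
  refine ⟨(e.hom.app (unit R)).hom ∘ₗ p, s ∘ₗ (e.inv.app (unit R)).hom, ?_⟩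
  ext x
  change e.hom.app (unit R) (p (s (e.inv.app (unit R) x))) = x
  have hps (z) : p (s z) = z := by
    obtain ⟨n, y, rfl⟩ := hi_surj z
    rw [hsi]
    exact LinearMap.congr_fun (hpi n) y
  rw [hps]
  change (e.inv.app (unit R) ≫ e.hom.app (unit R)) x = x
  simp

end AdmissiblePro

end

/-! ### The Tate object of Laurent series -/

section

section LaurentTate

open ProjFG

variable {R : Type v} [CommRing R]

variable (R) in
/-- The free module of rank `n`. -/
def freeFG (n : ℕ) : ProjFG R :=
  ⟨FGModuleRepr.ofFinite R (Fin n → R),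
    Module.Projective.of_equiv (FGModuleRepr.ofFiniteEquiv R (Fin n → R)).symm⟩

variable (R) in
/-- The identification of the free module of rank `n` with `Rⁿ`. -/
def freeEquiv (n : ℕ) : (freeFG R n).1 ≃ₗ[R] (Fin n → R) := FGModuleRepr.ofFiniteEquiv R _

/-- The `k`-th standard basis vector; it is zero for `k ≥ n`. -/
def freeBasis (n k : ℕ) : (freeFG R n).1 :=
  (freeEquiv R n).symm fun i => if i.1 = k then 1 else 0

/-- The linear map sending the standard basis vectors to the given elements. -/
def freeLift (n : ℕ) {M : Type*} [AddCommGroup M] [Module R M] (a : ℕ → M) :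
    (freeFG R n).1 →ₗ[R] M :=
  Fintype.linearCombination R (fun i : Fin n => a i) ∘ₗ (freeEquiv R n).toLinearMap

theorem freeLift_basis (n k : ℕ) {M : Type*} [AddCommGroup M] [Module R M] (a : ℕ → M) :
    freeLift n a (freeBasis n k : (freeFG R n).1) = if k < n then a k else 0 := by
  simp only [freeLift, freeBasis, LinearMap.comp_apply, LinearEquiv.coe_coe,
    LinearEquiv.apply_symm_apply, Fintype.linearCombination_apply, ite_smul, one_smul, zero_smul]
  split_ifs with h
  · rw [Finset.sum_eq_single (⟨k, h⟩ : Fin n)]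
    · simp
    · intro b _ hb
      exact if_neg fun h' => hb (Fin.ext h')
    · simp
  · exact Finset.sum_eq_zero fun i _ => if_neg (by omega)

theorem freeLift_eq (n : ℕ) {M : Type*} [AddCommGroup M] [Module R M]
    (f : (freeFG R n).1 →ₗ[R] M) : freeLift n (fun k => f (freeBasis n k)) = f := by
  have : f = (f ∘ₗ (freeEquiv R n).symm.toLinearMap) ∘ₗ (freeEquiv R n).toLinearMap := by
    ext x; simp
  conv_rhs => rw [this]
  unfold freeLift
  congr 1
  refine LinearMap.pi_ext' fun i => LinearMap.ext_ring ?_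
  rw [LinearMap.comp_apply, LinearMap.comp_apply, LinearMap.single_apply,
    Fintype.linearCombination_apply_single, one_smul]
  change f _ = f _
  congr 1
  unfold freeBasis
  change (freeEquiv R n).symm _ = (freeEquiv R n).symm _
  congr 1
  ext j
  simp [Pi.single_apply, Fin.ext_iff]

theorem freeBasis_eq_zero {n k : ℕ} (h : n ≤ k) : (freeBasis n k : (freeFG R n).1) = 0 := by
  unfold freeBasis
  rw [← map_zero (freeEquiv R n).symm]
  congr 1
  funext i
  exact if_neg (by omega)

variable (R) in
/-- The inverse system of the free modules of finite rank. -/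
def freeSystem : ℕ ⥤ (ProjFG R)ᵒᵖ where
  obj n := op (freeFG R n)
  map {i j} f := (ofLinear (freeLift j fun k => freeBasis i k)).op
  map_id n := by
    congr 1
    refine hom_ext_apply fun x => ?_
    exact LinearMap.congr_fun (freeLift_eq n LinearMap.id) x
  map_comp {i j k} f g := by
    rw [← op_comp]
    congr 1
    refine hom_ext_apply fun x => ?_
    change freeLift k _ x = freeLift j _ (freeLift k _ x)
    rw [← LinearMap.comp_apply, ← freeLift_eq k (freeLift j _ ∘ₗ freeLift k _)]
    congr! 3 with l
    rw [LinearMap.comp_apply, freeLift_basis]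
    split_ifs with h
    · rw [freeLift_basis]
      split_ifs with h'
      · rfl
      · exact freeBasis_eq_zero (by have := leOfHom f; omega)
    · rw [map_zero]
      exact freeBasis_eq_zero (by have := leOfHom f; have := leOfHom g; omega)

theorem freeSystem_map_basis {i j : ℕ} (f : i ⟶ j) (k : ℕ) :
    ((freeSystem R).map f).unop.hom (freeBasis j k) = freeBasis i k := by
  refine (freeLift_basis j k _).trans ?_
  by_cases h : k < j
  · exact if_pos h
  · exact (if_neg h).trans (freeBasis_eq_zero (by have := leOfHom f; omega)).symm

theorem freeSystem_map_surjective {i j : ℕ} (f : i ⟶ j) :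
    Function.Surjective ((freeSystem R).map f).unop.hom := by
  intro x
  refine ⟨freeLift i (fun k => freeBasis j k) x, ?_⟩
  let g : (freeFG R j).1 →ₗ[R] (freeFG R i).1 := ((freeSystem R).map f).unop.hom.hom
  have hg : g ∘ₗ freeLift i (fun k => freeBasis j k) = LinearMap.id := by
    rw [← freeLift_eq i (g ∘ₗ _), ← freeLift_eq i LinearMap.id]
    congr 1
    funext k
    rw [LinearMap.comp_apply, freeLift_basis]
    split_ifs with h
    · exact freeSystem_map_basis f k
    · exact (map_zero _).trans (freeBasis_eq_zero (by omega)).symm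
  exact LinearMap.congr_fun hg x

variable (R) in
/-- The functor `A ↦ A^{(ℕ)}`. -/
def finsuppFunctor : ProjFG R ⥤ ModuleCat.{v} R where
  obj A := ModuleCat.of R (ℕ →₀ A.1)
  map f := ModuleCat.ofHom (Finsupp.mapRange.linearMap f.hom.hom)
  map_id A := by
    ext1
    exact Finsupp.mapRange.linearMap_id
  map_comp f g := by
    ext1
    exact Finsupp.mapRange.linearMap_comp _ _

/-- The values of a morphism on the standard basis vectors. -/
def freeCoords (n : ℕ) (A : ProjFG R) : (freeFG R n ⟶ A) →ₗ[R] (ℕ →₀ A.1) where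
  toFun f := Finsupp.onFinset (Finset.range n) (fun k => f.hom (freeBasis n k)) fun k hk => by
    by_contra h
    exact hk (by rw [freeBasis_eq_zero (by simpa using h)]; exact map_zero _)
  map_add' f g := by
    ext k
    rfl
  map_smul' r f := by
    ext k
    rfl

theorem freeCoords_apply (n : ℕ) {A : ProjFG R} (f : freeFG R n ⟶ A) (k : ℕ) :
    freeCoords n A f k = f.hom (freeBasis n k) := rfl

theorem freeCoords_injective (n : ℕ) (A : ProjFG R) : Function.Injective (freeCoords (R := R) n A) := by
  intro f g h
  refine hom_ext_apply fun x => ?_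
  change f.hom.hom x = g.hom.hom x
  rw [← freeLift_eq n f.hom.hom, ← freeLift_eq n g.hom.hom]
  congr! 3 with k
  exact DFunLike.congr_fun h k

theorem freeCoords_ofLinear_freeLift {n : ℕ} {A : ProjFG R} (x : ℕ →₀ A.1)
    (hx : ∀ k, n ≤ k → x k = 0) : freeCoords n A (ofLinear (freeLift n x)) = x := by
  ext k
  rw [freeCoords_apply, ofLinear_apply, freeLift_basis]
  split_ifs with h
  · rfl
  · exact (hx k (by omega)).symm

theorem exists_bound {A : Type*} [Zero A] (x : ℕ →₀ A) : ∃ n, ∀ k, n ≤ k → x k = 0 := by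
  refine ⟨x.support.sup id + 1, fun k hk => ?_⟩
  by_contra h
  have := Finset.le_sup (f := id) (Finsupp.mem_support_iff.2 h)
  simp only [id] at this
  omega

/-- The values on the standard basis vectors, as a natural transformation. -/
def freeCoordsHom (n : ℕ) :
    (linearCoyoneda R (ProjFG R)).obj (op (freeFG R n)) ⟶ finsuppFunctor R where
  app A := ModuleCat.ofHom (freeCoords n A)
  naturality A B f := by
    ext x : 2
    exact Finsupp.ext fun k => rfl

variable (R) in
-- A morphism from `"lim" Rⁿ` to `A` is given by the images of the basis vectors, all but finitely
-- many of which vanish; so `A ↦ A^{(ℕ)}` is the colimit of the functors `Hom(Rⁿ, -)`.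
theorem isAdmissiblePro_finsuppFunctor : IsAdmissiblePro R (finsuppFunctor R) := by
  let c : Cocone (freeSystem R ⋙ linearCoyoneda R (ProjFG R)) :=
    { pt := finsuppFunctor R
      ι :=
        { app := fun n => freeCoordsHom n
          naturality := fun i j f => by
            ext A x : 4
            refine Finsupp.ext fun k => ?_
            change x.hom ((((freeSystem R).map f).unop).hom (freeBasis j k)) = x.hom (freeBasis i k)
            rw [freeSystem_map_basis] } }
  refine ⟨ℕ, inferInstance, inferInstance, inferInstance, inferInstance, freeSystem R, c,
    fun i j f => freeSystem_map_surjective f,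
    nonempty_isColimit_of_jointly_bijective (fun A x => ?_) fun n A => freeCoords_injective n A,
    ⟨Iso.refl _⟩⟩
  obtain ⟨x, rfl⟩ : ∃ y : ℕ →₀ A.1, y = x := ⟨x, rfl⟩
  obtain ⟨n, hn⟩ := exists_bound x
  exact ⟨n, ofLinear (freeLift n x), freeCoords_ofLinear_freeLift x hn⟩

variable (R) in
/-- The pro-object `"lim" Rⁿ`, as an object of the opposite category. -/
def finsuppPro : ProjProOp R := ⟨finsuppFunctor R, isAdmissiblePro_finsuppFunctor R⟩

/-- The endomorphism `x ↦ (k ↦ x (k + m))`. -/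
def shiftLinear (m : ℕ) (A : Type*) [AddCommGroup A] [Module R A] : (ℕ →₀ A) →ₗ[R] (ℕ →₀ A) :=
  Finsupp.lcomapDomain (· + m) (add_left_injective m)

theorem shiftLinear_apply (m : ℕ) {A : Type*} [AddCommGroup A] [Module R A] (x : ℕ →₀ A) (k : ℕ) :
    shiftLinear (R := R) m A x k = x (k + m) := rfl

theorem shiftLinear_surjective (m : ℕ) (A : Type*) [AddCommGroup A] [Module R A] :
    Function.Surjective (shiftLinear (R := R) m A) := fun x =>
  ⟨x.embDomain ⟨(· + m), add_left_injective m⟩, Finsupp.ext fun k =>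
    Finsupp.embDomain_apply_self ⟨(· + m), add_left_injective m⟩ x k⟩

/-- The shift by `m`, as an endomorphism of the pro-object. -/
def shift (m : ℕ) : finsuppPro R ⟶ finsuppPro R := ObjectProperty.homMk
  { app := fun A => ModuleCat.ofHom (shiftLinear m A.1)
    naturality := fun A B f => by
      ext x : 2
      exact Finsupp.ext fun k => rfl }

variable (R) in
/-- The system of the pro-objects `t⁻ⁿ R⟦t⟧`. -/
def laurentSystem : ℕ ⥤ ProjPro R where
  obj _ := op (finsuppPro R)
  map {i j} f := (shift (j - i)).op
  map_id n := by
    rw [Nat.sub_self, ← op_id]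
    congr 1
    ext A x : 5
    exact Finsupp.ext fun k => rfl
  map_comp {i j k} f g := by
    rw [← op_comp]
    congr 1
    ext A x : 5
    obtain ⟨x, rfl⟩ : ∃ y : ℕ →₀ A.1, y = x := ⟨x, rfl⟩
    refine Finsupp.ext fun l => ?_
    change x (l + (k - i)) = x (l + (j - i) + (k - j))
    congr 1
    have := leOfHom f
    have := leOfHom g
    omega

theorem freeCoords_exact (m : ℕ) (A : ProjFG R) :
    Function.Exact (freeCoords m A) (shiftLinear (R := R) m A.1) := by
  intro x
  constructor
  · intro hx
    refine ⟨ofLinear (freeLift m x), freeCoords_ofLinear_freeLift _ fun k hk => ?_⟩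
    have := DFunLike.congr_fun hx (k - m)
    rwa [shiftLinear_apply, Nat.sub_add_cancel hk] at this
  · rintro ⟨f, rfl⟩
    refine Finsupp.ext fun k => ?_
    rw [shiftLinear_apply, freeCoords_apply, freeBasis_eq_zero (by omega)]
    exact map_zero _

/-- The shift is dual to multiplication by `t^m` on `R⟦t⟧`, whose cokernel is free of rank `m` on
the first `m` coefficients. -/
theorem isAdmissibleMonoWithFGCokernel_shift (m : ℕ) :
    IsAdmissibleMonoWithFGCokernel (X := op (finsuppPro R)) (Y := op (finsuppPro R))
      (shift m).op := by
  let g : (ProjPro.const (freeFG R m)).unop ⟶ finsuppPro R := ObjectProperty.homMk (freeCoordsHom m)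
  refine ⟨freeFG R m, g.op, fun A => ⟨freeCoords_injective m A, fun x => ?_,
    shiftLinear_surjective m A.1⟩⟩
  obtain ⟨x, rfl⟩ : ∃ y : ℕ →₀ A.1, y = x := ⟨x, rfl⟩
  exact freeCoords_exact m A x

/-- Laurent series with coefficients in a module. -/
def laurentSubmodule (R : Type v) [CommRing R] (M : Type*) [AddCommGroup M] [Module R M] :
    Submodule R (ℤ → M) where
  carrier := {f | ∃ n : ℤ, ∀ k < n, f k = 0}
  zero_mem' := ⟨0, fun _ _ => rfl⟩
  add_mem' := by
    rintro f g ⟨m, hf⟩ ⟨n, hg⟩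
    refine ⟨min m n, fun k hk => ?_⟩
    rw [Pi.add_apply, hf k (hk.trans_le (min_le_left _ _)), hg k (hk.trans_le (min_le_right _ _)),
      add_zero]
  smul_mem' := by
    rintro r f ⟨n, hf⟩
    exact ⟨n, fun k hk => by rw [Pi.smul_apply, hf k hk, smul_zero]⟩

/-- The map of Laurent series induced by a map of modules. -/
def laurentMap {M N : Type*} [AddCommGroup M] [Module R M] [AddCommGroup N] [Module R N]
    (f : M →ₗ[R] N) : laurentSubmodule R M →ₗ[R] laurentSubmodule R N where
  toFun x := ⟨fun k => f (x.1 k), x.2.imp fun _ hn k hk => (congrArg f (hn k hk)).trans (map_zero f)⟩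
  map_add' _ _ := Subtype.ext (funext fun _ => map_add f _ _)
  map_smul' _ _ := Subtype.ext (funext fun _ => map_smul f _ _)

variable (R) in
/-- The Tate object `R((t))`: it sends `F` to the Laurent series with coefficients in `F(R)`. -/
def laurentTate : ProjProOp R ⥤ ModuleCat.{v} R where
  obj F := ModuleCat.of R (laurentSubmodule R (F.obj.obj (unit R)))
  map φ := ModuleCat.ofHom (laurentMap (φ.hom.app (unit R)).hom)

/-- The basis vectors of `R^{(ℕ)}`, extended by zero to the integers. -/
def finsuppBasis (k : ℤ) : ℕ →₀ (unit R).1 :=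
  if 0 ≤ k then Finsupp.single k.toNat one else 0

theorem finsuppBasis_natCast (k : ℕ) :
    (finsuppBasis (k : ℤ) : ℕ →₀ (unit R).1) = Finsupp.single k one := by
  rw [finsuppBasis, if_pos (by omega), Int.toNat_natCast]

theorem finsuppBasis_eq_zero {k : ℤ} (hk : k < 0) : (finsuppBasis k : ℕ →₀ (unit R).1) = 0 :=
  if_neg (by omega)

theorem shiftLinear_finsuppBasis (m : ℕ) (k : ℤ) :
    shiftLinear (R := R) m (unit R).1 (finsuppBasis k) = finsuppBasis (k - m) := by
  ext l : 1
  rw [shiftLinear_apply]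
  unfold finsuppBasis
  split_ifs with h1 h2 h2
  · rw [Finsupp.single_apply, Finsupp.single_apply]
    congr 1
    apply propext
    omega
  · rw [Finsupp.single_apply, if_neg (by omega), Finsupp.zero_apply]
  · omega
  · rfl

theorem finsuppUnit_hom_ext {M : Type*} [AddCommGroup M] [Module R M]
    {f g : (ℕ →₀ (unit R).1) →ₗ[R] M} (h : ∀ k : ℕ, f (finsuppBasis k) = g (finsuppBasis k)) :
    f = g := by
  refine Finsupp.lhom_ext' fun k => ?_
  have key : ∀ f : (unit R).1 →ₗ[R] M, f = LinearMap.toSpanSingleton R M (f one) ∘ₗ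
      (unitEquiv R).toLinearMap := fun f => by
    ext x
    rw [LinearMap.comp_apply, LinearMap.toSpanSingleton_apply, ← map_smul]
    congr 1
    apply (unitEquiv R).injective
    simp [one]
  rw [key (f ∘ₗ _), key (g ∘ₗ _)]
  congr 2
  have := h k
  rwa [finsuppBasis_natCast] at this

/-- The linear map on `R^{(ℕ)}` with the given values at the basis vectors. -/
def finsuppLift {M : Type*} [AddCommGroup M] [Module R M] (a : ℕ → M) :
    (ℕ →₀ (unit R).1) →ₗ[R] M :=
  Finsupp.lsum R fun k => LinearMap.toSpanSingleton R M (a k) ∘ₗ (unitEquiv R).toLinearMap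

theorem finsuppLift_basis {M : Type*} [AddCommGroup M] [Module R M] (a : ℕ → M) (k : ℕ) :
    finsuppLift a (finsuppBasis k : ℕ →₀ (unit R).1) = a k := by
  rw [finsuppBasis_natCast, finsuppLift, Finsupp.lsum_single]
  simp [one]

theorem finsuppPro_hom_ext {F : ProjProOp R} {φ ψ : finsuppPro R ⟶ F}
    (h : ∀ k : ℕ, φ.hom.app (unit R) (finsuppBasis k) = ψ.hom.app (unit R) (finsuppBasis k)) :
    φ = ψ := by
  have : (finsuppFunctor R).Additive := (isAdmissiblePro_finsuppFunctor R).additive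
  ext1
  refine natTrans_ext_unit (F := finsuppFunctor R) fun x => ?_
  exact LinearMap.congr_fun (finsuppUnit_hom_ext (f := (φ.hom.app (unit R)).hom)
    (g := (ψ.hom.app (unit R)).hom) h) x

/-- The value of `finsuppFunctor R` at the unit is free on the basis vectors, so a morphism is an
arbitrary sequence in `F(R)`. -/
theorem exists_finsuppPro_hom {F : ProjProOp R} (a : ℕ → F.obj.obj (unit R)) :
    ∃ φ : finsuppPro R ⟶ F, ∀ k : ℕ, φ.hom.app (unit R) (finsuppBasis k) = a k := by
  have : (finsuppFunctor R).Additive := (isAdmissiblePro_finsuppFunctor R).additive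
  have : (finsuppFunctor R).Linear R := (isAdmissiblePro_finsuppFunctor R).linear
  refine ⟨ObjectProperty.homMk (natTransOfUnit (F := finsuppFunctor R) (finsuppLift a)),
    fun k => ?_⟩
  exact (natTransOfUnit_app (F := finsuppFunctor R) (finsuppLift a) _).trans (finsuppLift_basis a k)

/-- The structure maps of the Tate object `R((t)) = "colim" t⁻ⁿ R⟦t⟧`. -/
def laurentLeg (n : ℕ) :
    (linearCoyoneda R (ProjProOp R)).obj (op (finsuppPro R)) ⟶ laurentTate R where
  app F := ModuleCat.ofHom
    { toFun := fun φ => ⟨fun k => φ.hom.app (unit R) (finsuppBasis (k + n)), -n, fun k hk =>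
          (congrArg (φ.hom.app (unit R)) (finsuppBasis_eq_zero (by omega))).trans (map_zero _)⟩
      map_add' := fun _ _ => rfl
      map_smul' := fun _ _ => rfl }

variable (R) in
/-- The presentation of the Tate object `R((t))` as a formal colimit. -/
def laurentCocone : Cocone (laurentSystem R ⋙ linearCoyoneda R (ProjProOp R)) where
  pt := laurentTate R
  ι :=
    { app := fun n => laurentLeg n
      naturality := fun i j f => by
        ext F φ : 4
        refine Subtype.ext (funext fun k => ?_)
        change φ.hom.app (unit R) (shiftLinear (j - i) (unit R).1 (finsuppBasis (k + j))) =
          φ.hom.app (unit R) (finsuppBasis (k + i))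
        rw [shiftLinear_finsuppBasis]
        congr 2
        have := leOfHom f
        omega }

variable (R) in
-- The `n`-th leg identifies sequences in `F(R)` with the Laurent families that vanish below degree
-- `-n`, and these exhaust all Laurent families.
theorem nonempty_isColimit_laurentCocone : Nonempty (IsColimit (laurentCocone R)) := by
  refine nonempty_isColimit_of_jointly_bijective (fun F x => ?_) (fun n F φ ψ h => ?_)
  · obtain ⟨⟨a, n, hn⟩, rfl⟩ : ∃ y : laurentSubmodule R (F.obj.obj (unit R)), y = x := ⟨x, rfl⟩
    -- The family starts in degree `n` or later; stage `(-n).toNat` contains it also when `n` is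
    -- positive.
    obtain ⟨φ, hφ⟩ := exists_finsuppPro_hom (F := F) fun k => a (k - (-n).toNat)
    refine ⟨(-n).toNat, φ, Subtype.ext (funext fun k => ?_)⟩
    change φ.hom.app (unit R) (finsuppBasis (k + (-n).toNat)) = a k
    by_cases hk : 0 ≤ k + (-n).toNat
    · have := hφ (k + (-n).toNat).toNat
      rw [Int.toNat_of_nonneg hk] at this
      rw [this]
      congr 1
      omega
    · rw [finsuppBasis_eq_zero (by omega), hn k (by omega)]
      exact map_zero _
  · refine finsuppPro_hom_ext fun k => ?_
    have := congrFun (congrArg Subtype.val h) (k - n)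
    change φ.hom.app (unit R) (finsuppBasis (k - n + n)) =
      ψ.hom.app (unit R) (finsuppBasis (k - n + n)) at this
    rwa [sub_add_cancel] at this

variable (R) in
theorem isElementaryTate_laurentTate : IsElementaryTate R (laurentTate R) :=
  ⟨ℕ, inferInstance, inferInstance, inferInstance, inferInstance, laurentSystem R,
    laurentCocone R, fun _ _ _ => isAdmissibleMonoWithFGCokernel_shift _,
    nonempty_isColimit_laurentCocone R, ⟨Iso.refl _⟩⟩

end LaurentTate

end

/-! ### Compatible dual bases along a tower of surjections -/

section

section DualBases

variable {R : Type v} [CommRing R]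

/-- `p` and `s` exhibit `D` as a retract of the finitely supported functions on the integers
`k ≥ -M`. -/
structure IsDualBasis {D : Type*} [AddCommGroup D] [Module R D] (M : ℕ)
    (p : (ℤ →₀ R) →ₗ[R] D) (s : D →ₗ[R] (ℤ →₀ R)) : Prop where
  comp_eq : p ∘ₗ s = LinearMap.id
  eq_zero : ∀ k : ℤ, k < -M → p (Finsupp.single k 1) = 0
  apply_eq_zero : ∀ y, ∀ k : ℤ, k < -M → s y k = 0

theorem exists_isDualBasis_of_retract {D : Type*} [AddCommGroup D] [Module R D]
    {p : (ℕ →₀ R) →ₗ[R] D} {s : D →ₗ[R] (ℕ →₀ R)} (h : p ∘ₗ s = LinearMap.id) :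
    ∃ (p : (ℤ →₀ R) →ₗ[R] D) (s : D →ₗ[R] (ℤ →₀ R)), IsDualBasis 0 p s := by
  refine ⟨p ∘ₗ Finsupp.lcomapDomain (fun n : ℕ => (n : ℤ)) Nat.cast_injective,
    Finsupp.lmapDomain R R (fun n : ℕ => (n : ℤ)) ∘ₗ s, ?_, fun k hk => ?_, fun y k hk => ?_⟩
  · refine LinearMap.ext fun x => ?_
    change p (Finsupp.comapDomain _ (Finsupp.mapDomain _ (s x)) _) = x
    rw [Finsupp.comapDomain_mapDomain _ Nat.cast_injective]
    exact LinearMap.congr_fun h x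
  · rw [LinearMap.comp_apply]
    convert map_zero p
    refine Finsupp.ext fun n => ?_
    change Finsupp.single k (1 : R) (n : ℤ) = 0
    rw [Finsupp.single_apply, if_neg (by omega)]
  · exact Finsupp.mapDomain_of_notMem_range _ _ (by rintro ⟨n, rfl⟩; simp at hk; omega)

/-- Since `D` is projective as well, `D'` splits as `D ⊕ ker π`. The old dual basis is used on the
first summand; the kernel is finitely generated and receives finitely many new vectors, placed below
degree `-M` so that the old coordinates are untouched. -/
theorem IsDualBasis.exists_lift {D D' : Type*} [AddCommGroup D] [Module R D] [AddCommGroup D']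
    [Module R D'] [Module.Projective R D'] {M : ℕ} {p : (ℤ →₀ R) →ₗ[R] D}
    {s : D →ₗ[R] (ℤ →₀ R)} (h : IsDualBasis M p s) (π : D' →ₗ[R] D)
    (hπ : Function.Surjective π) (hK : (LinearMap.ker π).FG) :
    ∃ (M' : ℕ) (p' : (ℤ →₀ R) →ₗ[R] D') (s' : D' →ₗ[R] (ℤ →₀ R)), IsDualBasis M' p' s' ∧
      M < M' ∧ π ∘ₗ p' = p ∧ ∀ y, ∀ k : ℤ, -M ≤ k → s' y k = s (π y) k := by
  obtain ⟨l, hl⟩ := Module.projective_lifting_property π p hπ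
  -- `σ` is a section of `π`. The basis vectors are lifted by `σ ∘ p` rather than by `l`, which
  -- might not vanish in degrees below `-M`.
  let σ := l ∘ₗ s
  have hσ : π ∘ₗ σ = LinearMap.id := by rw [← LinearMap.comp_assoc, hl, h.comp_eq]
  have : Module.Finite R (LinearMap.ker π) := Module.Finite.iff_fg.2 hK
  obtain ⟨m, q, hq⟩ := Module.Finite.exists_fin' R (LinearMap.ker π)
  have hσπ (y : D') : y - σ (π y) ∈ LinearMap.ker π := by
    rw [LinearMap.mem_ker, map_sub, ← LinearMap.comp_apply, hσ, LinearMap.id_apply, sub_self]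
  obtain ⟨w, hw⟩ := Module.projective_lifting_property q
    (LinearMap.codRestrict (LinearMap.ker π) (LinearMap.id - σ ∘ₗ π) hσπ) hq
  let q' : (Fin m → R) →ₗ[R] D' := (LinearMap.ker π).subtype ∘ₗ q
  have hq' : π ∘ₗ q' = 0 := LinearMap.ext fun a => (q a).2
  have hw' (y : D') : q' (w y) = y - σ (π y) := congrArg Subtype.val (LinearMap.congr_fun hw y)
  -- The first `m` degrees below `-M`, in which both `p` and `s` vanish.
  let j (i : Fin m) : ℤ := -M - 1 - i.1
  have hj : Function.Injective j := fun a b hab => Fin.ext (by simp only [j] at hab; omega)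
  let ι : (Fin m → R) →ₗ[R] (ℤ →₀ R) :=
    Finsupp.lmapDomain R R j ∘ₗ (Finsupp.linearEquivFunOnFinite R R (Fin m)).symm.toLinearMap
  let ρ : (ℤ →₀ R) →ₗ[R] (Fin m → R) :=
    (Finsupp.linearEquivFunOnFinite R R (Fin m)).toLinearMap ∘ₗ Finsupp.lcomapDomain j hj
  have hρ (f : ℤ →₀ R) (i : Fin m) : ρ f i = f (j i) := rfl
  have hρι (a : Fin m → R) : ρ (ι a) = a := by
    funext i
    rw [hρ]
    exact Finsupp.mapDomain_apply hj _ _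
  have hι (a : Fin m → R) (k : ℤ) (hk : ∀ i, j i ≠ k) : ι a k = 0 :=
    Finsupp.mapDomain_of_notMem_range _ _ (by rintro ⟨i, rfl⟩; exact hk i rfl)
  have hpι : p ∘ₗ ι = 0 := by
    refine LinearMap.pi_ext' fun i => LinearMap.ext_ring ?_
    have : ι (Pi.single i 1) = Finsupp.single (j i) 1 := by
      change Finsupp.mapDomain j _ = _
      rw [← Finsupp.mapDomain_single]
      congr 1
      exact Finsupp.linearEquivFunOnFinite_symm_single R R _ i 1
    rw [LinearMap.comp_apply, LinearMap.comp_apply, LinearMap.single_apply, this]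
    exact h.eq_zero _ (by simp only [j]; omega)
  have hρs (y : D) : ρ (s y) = 0 := by
    funext i
    exact h.apply_eq_zero _ _ (by simp only [j]; omega)
  -- The cross terms `p ∘ ι` and `ρ ∘ s` vanish, so the composite is `σ ∘ π + (id - σ ∘ π)`. The
  -- extra `1` makes the bound grow strictly even if `m = 0`, so that the bounds tend to infinity
  -- along a tower.
  refine ⟨M + m + 1, σ ∘ₗ p + q' ∘ₗ ρ, s ∘ₗ π + ι ∘ₗ w, ⟨?_, fun k hk => ?_, fun y k hk => ?_⟩,
    by omega, ?_, fun y k hk => ?_⟩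
  · refine LinearMap.ext fun y => ?_
    have h1 : p (s (π y)) = π y := LinearMap.congr_fun h.comp_eq _
    have h2 : p (ι (w y)) = 0 := LinearMap.congr_fun hpι _
    simp only [LinearMap.comp_apply, LinearMap.add_apply, map_add, h1, h2, hρs, hρι, hw', map_zero,
      LinearMap.id_apply]
    abel
  · push_cast at hk
    rw [LinearMap.add_apply, LinearMap.comp_apply, h.eq_zero k (by omega), map_zero, zero_add,
      LinearMap.comp_apply]
    convert map_zero q'
    funext i
    rw [hρ, Finsupp.single_apply, if_neg (by simp only [j]; omega), Pi.zero_apply]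
  · push_cast at hk
    rw [LinearMap.add_apply, Finsupp.add_apply, LinearMap.comp_apply, LinearMap.comp_apply,
      h.apply_eq_zero _ k (by omega), hι _ k (fun i => by simp only [j]; omega), add_zero]
  · rw [LinearMap.comp_add, ← LinearMap.comp_assoc p, ← LinearMap.comp_assoc ρ, hσ, hq',
      LinearMap.id_comp, LinearMap.zero_comp, add_zero]
  · rw [LinearMap.add_apply, Finsupp.add_apply, LinearMap.comp_apply, LinearMap.comp_apply,
      hι _ k (fun i => by simp only [j]; omega), add_zero]

/-- A tower of surjections with finitely generated kernels between countably generated projective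
modules has compatible dual bases. -/
theorem exists_compatible_isDualBasis {D : ℕ → Type*} [∀ n, AddCommGroup (D n)]
    [∀ n, Module R (D n)] (hD : ∀ n, ∃ (p : (ℕ →₀ R) →ₗ[R] D n) (s : D n →ₗ[R] (ℕ →₀ R)),
      p ∘ₗ s = LinearMap.id)
    (π : ∀ n, D (n + 1) →ₗ[R] D n) (hπ : ∀ n, Function.Surjective (π n))
    (hK : ∀ n, (LinearMap.ker (π n)).FG) :
    ∃ (M : ℕ → ℕ) (p : ∀ n, (ℤ →₀ R) →ₗ[R] D n) (s : ∀ n, D n →ₗ[R] (ℤ →₀ R)),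
      (∀ n, IsDualBasis (M n) (p n) (s n)) ∧ (∀ n, n ≤ M n) ∧ (∀ n, π n ∘ₗ p (n + 1) = p n) ∧
      ∀ (n : ℕ) (y), ∀ k : ℤ, -n ≤ k → s (n + 1) y k = s n (π n y) k := by
  have hproj (n : ℕ) : Module.Projective R (D n) := by
    obtain ⟨p, s, h⟩ := hD n
    exact Module.Projective.of_split s p h
  obtain ⟨p₀, s₀, h₀⟩ : ∃ (p : (ℤ →₀ R) →ₗ[R] D 0) (s : D 0 →ₗ[R] (ℤ →₀ R)),
      IsDualBasis 0 p s := by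
    obtain ⟨p, s, h⟩ := hD 0
    exact exists_isDualBasis_of_retract h
  let T (n : ℕ) := {d : ℕ × ((ℤ →₀ R) →ₗ[R] D n) × (D n →ₗ[R] (ℤ →₀ R)) //
    IsDualBasis d.1 d.2.1 d.2.2}
  have step (n : ℕ) (d : T n) : ∃ d' : T (n + 1), d.1.1 < d'.1.1 ∧ π n ∘ₗ d'.1.2.1 = d.1.2.1 ∧
      ∀ y, ∀ k : ℤ, -d.1.1 ≤ k → d'.1.2.2 y k = d.1.2.2 (π n y) k := by
    obtain ⟨M', p', s', h', h⟩ := d.2.exists_lift (π n) (hπ n) (hK n)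
    exact ⟨⟨(M', p', s'), h'⟩, h⟩
  choose next hnext using step
  let d : ∀ n, T n := fun n => Nat.rec ⟨(0, p₀, s₀), h₀⟩ next n
  have hd (n : ℕ) : d (n + 1) = next n (d n) := rfl
  have hM (n : ℕ) : n ≤ (d n).1.1 := by
    induction n with
    | zero => exact Nat.zero_le _
    | succ n ih => rw [hd]; exact Nat.succ_le_of_lt (ih.trans_lt (hnext n (d n)).1)
  refine ⟨fun n => (d n).1.1, fun n => (d n).1.2.1, fun n => (d n).1.2.2, fun n => (d n).2, hM,
    fun n => (hnext n (d n)).2.1, fun n y k hk => (hnext n (d n)).2.2 y k ?_⟩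
  have := hM n
  omega

end DualBases

end

/-! ### Elementary Tate objects are retracts of Laurent series -/

section

section Retracts

open ProjFG

variable {R : Type v} [CommRing R]

/-- The morphism to the Tate object `R((t))` given by an element. -/
def laurentYoneda {F : ProjProOp R} (x : laurentSubmodule R (F.obj.obj (unit R))) :
    (linearCoyoneda R (ProjProOp R)).obj (op F) ⟶ laurentTate R where
  app G := ModuleCat.ofHom
    { toFun := fun φ => (laurentTate R).map φ x
      map_add' := fun _ _ => rfl
      map_smul' := fun _ _ => rfl }
  naturality G H ψ := by
    ext φ : 2
    exact Subtype.ext (funext fun k => rfl)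

theorem IsAdmissibleMonoWithFGCokernel.fg_ker {X Y : ProjPro R} {f : X ⟶ Y}
    (hf : IsAdmissibleMonoWithFGCokernel f) :
    (LinearMap.ker (f.unop.hom.app (unit R)).hom).FG := by
  obtain ⟨P, g, h⟩ := hf
  have h2 := (h (unit R)).2.1
  have : LinearMap.ker (f.unop.hom.app (unit R)).hom =
      LinearMap.range (g.unop.hom.app (unit R)).hom :=
    LinearMap.exact_iff.1 h2
  rw [this, LinearMap.range_eq_map]
  have : Module.Finite R ((ProjPro.const P).unop.obj.obj (unit R)) :=
    inferInstanceAs (Module.Finite R (P ⟶ unit R))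
  exact Module.Finite.fg_top.map _

/-- Dually, this is the map from `t⁻ⁿ R⟦t⟧` to the pro-object `D` determined by `s`, with only the
degrees at least `-n` retained. -/
theorem exists_truncation {D : ProjProOp R} (s : D.obj.obj (unit R) →ₗ[R] (ℤ →₀ R)) (n : ℕ) :
    ∃ θ : D ⟶ finsuppPro R, ∀ y, ∀ j : ℕ,
      unitEquiv R ((show ℕ →₀ (unit R).1 from θ.hom.app (unit R) y) j) = s y (j - n) := by
  have : (finsuppFunctor R).Additive := (isAdmissiblePro_finsuppFunctor R).additive
  have : (finsuppFunctor R).Linear R := (isAdmissiblePro_finsuppFunctor R).linear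
  let T : D.obj.obj (unit R) →ₗ[R] (ℕ →₀ (unit R).1) :=
    (Finsupp.mapRange.linearMap (unitEquiv R).symm.toLinearMap) ∘ₗ
      Finsupp.lcomapDomain (fun j : ℕ => (j - n : ℤ)) (fun a b h => by simpa using h) ∘ₗ s
  refine ⟨ObjectProperty.homMk (natTransOfUnit (F := D.obj) (G := finsuppFunctor R) T), fun y j => ?_⟩
  have h := natTransOfUnit_app (F := D.obj) (G := finsuppFunctor R) T y
  have h' := DFunLike.congr_fun (F := ℕ →₀ (unit R).1) h j
  refine (congrArg (unitEquiv R) h').trans ?_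
  exact (unitEquiv R).apply_symm_apply _

theorem finsuppUnit_ext {x y : ℕ →₀ (unit R).1}
    (h : ∀ j, unitEquiv R (x j) = unitEquiv R (y j)) : x = y :=
  Finsupp.ext fun j => (unitEquiv R).injective (h j)

/-- Dropping the coordinates below `-n` is harmless for a linear combination of vectors that vanish
there. -/
theorem finsuppUnit_lift_apply {M : Type*} [AddCommGroup M] [Module R M]
    (f : (ℕ →₀ (unit R).1) →ₗ[R] M) {a : ℤ → M} {n : ℕ} {c : ℤ →₀ R}
    (hf : ∀ j : ℕ, f (finsuppBasis j) = a (j - n)) (ha : ∀ k : ℤ, k < -n → a k = 0)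
    (z : ℕ →₀ (unit R).1) (hz : ∀ j : ℕ, unitEquiv R (z j) = c (j - n)) :
    f z = Finsupp.linearCombination R a c := by
  have hinj : Function.Injective fun j : ℕ => (j - n : ℤ) := fun a b h => by simpa using h
  have h1 : f = Finsupp.linearCombination R (fun j : ℕ => a (j - n)) ∘ₗ
      Finsupp.mapRange.linearMap (unitEquiv R).toLinearMap := by
    refine finsuppUnit_hom_ext fun k => ?_
    rw [hf, LinearMap.comp_apply, finsuppBasis_natCast]
    simp [one]
  have h2 : Finsupp.mapRange.linearMap (unitEquiv R).toLinearMap z =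
      Finsupp.comapDomain (fun j : ℕ => (j - n : ℤ)) c hinj.injOn := Finsupp.ext hz
  rw [h1, LinearMap.comp_apply, h2, Finsupp.linearCombination_comapDomain,
    Finsupp.linearCombination_apply, Finsupp.sum]
  refine Finset.sum_of_injOn (fun j : ℕ => (j - n : ℤ)) hinj.injOn ?_ ?_ fun _ _ => rfl
  · intro j hj
    simpa using hj
  · intro k hk hk'
    rw [ha k, smul_zero]
    by_contra! h
    have h3 : ((k + n).toNat : ℤ) - n = k := by omega
    refine hk' ⟨(k + n).toNat, ?_, h3⟩
    rw [Finset.mem_coe, Finset.mem_preimage, h3]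
    exact hk

/-- The vectors `p n (single k 1)` form a Laurent family over the `n`-th pro-object, that is, a map
to `R((t))`; the truncated coordinates `s n` give maps from `t⁻ⁿ R⟦t⟧` back. Compatibility of the
dual bases glues both, and `p ∘ s = id` makes the composite the identity. -/
theorem IsElementaryTate.nonempty_retract {E : ProjProOp R ⥤ ModuleCat.{v} R}
    (hE : IsElementaryTate R E) : Nonempty (Retract E (laurentTate R)) := by
  obtain ⟨I, _, _, _, _, X, c, hX, ⟨hc⟩, ⟨e⟩⟩ := hE
  suffices Nonempty (Retract c.pt (laurentTate R)) from
    this.map fun ρ => (Retract.ofIso e.symm).trans ρ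
  let Q := IsFiltered.sequentialFunctor I ⋙ X
  let c' : Cocone (Q ⋙ linearCoyoneda R (ProjProOp R)) :=
    c.whisker (IsFiltered.sequentialFunctor I)
  have hc' : IsColimit c' := (Functor.Final.isColimitWhiskerEquiv _ _).symm hc
  change Nonempty (Retract c'.pt (laurentTate R))
  clear_value c'
  have hQ ⦃i j : ℕ⦄ (f : i ⟶ j) : IsAdmissibleMonoWithFGCokernel (Q.map f) := hX _
  clear_value Q
  clear e hc hX c X
  let F (n : ℕ) : ProjProOp R := (Q.obj n).unop
  let π (n : ℕ) : F (n + 1) ⟶ F n := (Q.map (homOfLE (Nat.le_succ n))).unop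
  obtain ⟨M, p, s, hps, hM, hp, hs⟩ := exists_compatible_isDualBasis (R := R)
    (D := fun n => (F n).obj.obj (unit R)) (fun n => (F n).property.exists_dual_basis)
    (fun n => ((π n).hom.app (unit R)).hom)
    (fun n => by obtain ⟨P, g, h⟩ := hQ (homOfLE (Nat.le_succ n)); exact (h (unit R)).2.2)
    (fun n => (hQ (homOfLE (Nat.le_succ n))).fg_ker)
  let x (n : ℕ) : laurentSubmodule R ((F n).obj.obj (unit R)) :=
    ⟨fun k => p n (Finsupp.single k 1), -M n, (hps n).eq_zero⟩
  have hx (n : ℕ) : (laurentTate R).map (π n) (x (n + 1)) = x n :=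
    Subtype.ext (funext fun k => LinearMap.congr_fun (hp n) (Finsupp.single k 1))
  let a : Cocone (Q ⋙ linearCoyoneda R (ProjProOp R)) :=
    { pt := laurentTate R
      ι := NatTrans.ofSequence (fun n => laurentYoneda (x n)) fun n => by
        ext G φ : 4
        obtain ⟨φ, rfl⟩ : ∃ φ' : F n ⟶ G, φ' = φ := ⟨φ, rfl⟩
        change (laurentTate R).map (π n ≫ φ) (x (n + 1)) = (laurentTate R).map φ (x n)
        rw [← hx n, (laurentTate R).map_comp]
        rfl }
  have ha (n : ℕ) : a.ι.app n = laurentYoneda (x n) := rfl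
  -- The cutoff at degree `-n` is the one above which `s (n + 1)` and `s n` agree; this is what
  -- makes the maps `θ n` compatible.
  choose θ hθ using fun n => exists_truncation (s n) n
  have hθπ (n : ℕ) : θ (n + 1) ≫ shift 1 = π n ≫ θ n := by
    ext1
    refine natTrans_ext_unit fun y => ?_
    refine finsuppUnit_ext fun j => ?_
    refine (hθ (n + 1) y (j + 1)).trans ((Eq.trans ?_ (hs n y (j - n) (by omega))).trans
      (hθ n ((π n).hom.app (unit R) y) j).symm)
    congr 1
    push_cast
    ring
  let b : Cocone (laurentSystem R ⋙ linearCoyoneda R (ProjProOp R)) :=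
    { pt := c'.pt
      ι := NatTrans.ofSequence
        (fun n => (linearCoyoneda R (ProjProOp R)).map (θ n).op ≫ c'.ι.app n) fun n => by
          ext G φ : 4
          obtain ⟨φ, rfl⟩ : ∃ φ' : finsuppPro R ⟶ G, φ' = φ := ⟨φ, rfl⟩
          have h1 := congrArg (fun f => f.app G (θ n ≫ φ)) (c'.w (homOfLE (Nat.le_succ n)))
          change (c'.ι.app (n + 1)).app G (π n ≫ θ n ≫ φ) =
            (c'.ι.app n).app G (θ n ≫ φ) at h1
          change (c'.ι.app (n + 1)).app G (θ (n + 1) ≫ shift (n + 1 - n) ≫ φ) =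
            (c'.ι.app n).app G (θ n ≫ φ)
          rw [← h1, show n + 1 - n = 1 by omega, ← Category.assoc, hθπ, Category.assoc] }
  obtain ⟨hL⟩ := nonempty_isColimit_laurentCocone R
  refine ⟨⟨hc'.desc a, hL.desc b, hc'.hom_ext fun n => ?_⟩⟩
  refine (Category.assoc _ _ _).symm.trans ((congrArg (· ≫ hL.desc b) (hc'.fac a n)).trans ?_)
  refine Eq.trans ?_ (Category.comp_id _).symm
  ext G ψ : 4
  obtain ⟨ψ, rfl⟩ : ∃ ψ' : F n ⟶ G, ψ' = ψ := ⟨ψ, rfl⟩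
  -- The stage `max n (M n)` is late enough to contain the family `x n`, which vanishes below `-M
  -- n`, and to receive a transition map from stage `n`.
  obtain ⟨φ, hφ⟩ := exists_finsuppPro_hom (F := G)
    fun j => ψ.hom.app (unit R) ((x n).1 (j - max n (M n)))
  have hx0 (k : ℤ) (hk : k < -(max n (M n) : ℕ)) : (x n).1 k = 0 := (hps n).eq_zero k (by omega)
  have h1 : (laurentLeg (max n (M n))).app G φ = (laurentYoneda (x n)).app G ψ := by
    refine Subtype.ext (funext fun k => ?_)
    change φ.hom.app (unit R) (finsuppBasis (k + (max n (M n) : ℕ))) =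
      ψ.hom.app (unit R) ((x n).1 k)
    by_cases hk : 0 ≤ k + (max n (M n) : ℕ)
    · have h := hφ (k + (max n (M n) : ℕ)).toNat
      rw [Int.toNat_of_nonneg hk, add_sub_cancel_right] at h
      exact h
    · rw [hx0 k (by omega), finsuppBasis_eq_zero (by omega)]
      exact (map_zero _).trans (map_zero _).symm
  have h2 := congrArg (fun f => f.app G φ) (hL.fac b (max n (M n)))
  have h3 := congrArg (fun f => f.app G ψ) (c'.w (homOfLE (le_max_left n (M n))))
  change (hL.desc b).app G ((laurentLeg (max n (M n))).app G φ) =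
    (c'.ι.app (max n (M n))).app G (θ (max n (M n)) ≫ φ) at h2
  change (c'.ι.app (max n (M n))).app G ((Q.map (homOfLE (le_max_left n (M n)))).unop ≫ ψ) =
    (c'.ι.app n).app G ψ at h3
  change (hL.desc b).app G ((a.ι.app n).app G ψ) = (c'.ι.app n).app G ψ
  rw [ha, ← h1, h2, ← h3]
  suffices h : θ (max n (M n)) ≫ φ = (Q.map (homOfLE (le_max_left n (M n)))).unop ≫ ψ from
    congrArg ((c'.ι.app (max n (M n))).app G) h
  ext1
  refine natTrans_ext_unit fun y => ?_
  have h4 (k : ℤ) : (Q.map (homOfLE (le_max_left n (M n)))).unop.hom.app (unit R)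
      ((x (max n (M n))).1 k) = (x n).1 k := by
    have h := congrArg (fun f => f.app (F n) (𝟙 (F n))) (a.w (homOfLE (le_max_left n (M n))))
    rw [ha, ha] at h
    have h' := congrFun (congrArg Subtype.val h) k
    exact h'
  have h5 : Finsupp.linearCombination R (fun k => ψ.hom.app (unit R) ((x n).1 k)) =
      (ψ.hom.app (unit R)).hom ∘ₗ
        ((Q.map (homOfLE (le_max_left n (M n)))).unop.hom.app (unit R)).hom ∘ₗ
          p (max n (M n)) := by
    refine Finsupp.lhom_ext' fun k => LinearMap.ext_ring ?_
    refine (Finsupp.linearCombination_single R _ _).trans ?_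
    rw [one_smul, ← h4]
    rfl
  -- The truncation in `θ` only drops degrees in which `x n` vanishes, so the composite is `p ∘ s =
  -- id` at the later stage, followed by the transition map.
  refine (finsuppUnit_lift_apply (φ.hom.app (unit R)).hom
    (a := fun k => ψ.hom.app (unit R) ((x n).1 k)) hφ (fun k hk => ?_) _
    (hθ (max n (M n)) y)).trans ?_
  · rw [hx0 k hk]
    exact map_zero _
  · rw [h5]
    change ψ.hom.app (unit R) ((Q.map (homOfLE (le_max_left n (M n)))).unop.hom.app (unit R)
      (p (max n (M n)) (s (max n (M n)) y))) = _
    have h6 : p (max n (M n)) (s (max n (M n)) y) = y :=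
      LinearMap.congr_fun (hps (max n (M n))).comp_eq y
    rw [h6]
    rfl

end Retracts

end

/-! ### Linear topologies and the `t`-adic topology -/

section

section LinearTopologies

variable {R : Type v} [CommRing R] {M N : Type v} [AddCommGroup M] [Module R M] [AddCommGroup N]
  [Module R N]

theorem linTopology_continuous_of_le (B : Set (Submodule R M)) (B' : Set (Submodule R N))
    (f : M →ₗ[R] N) (h : ∀ V ∈ B', ∃ U ∈ B, U ≤ V.comap f) :
    Continuous[linTopology B, linTopology B'] f := by
  refine continuous_iInf_rng.2 fun V => continuous_induced_rng.2 ?_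
  obtain ⟨U, hU, hUV⟩ := h V.1 V.2
  refine continuous_iInf_dom (i := ⟨U, hU⟩) ?_
  let _ : TopologicalSpace (M ⧸ U) := ⊥
  have : DiscreteTopology (M ⧸ U) := ⟨rfl⟩
  let _ : TopologicalSpace (N ⧸ V.1) := ⊥
  have h1 : V.1.mkQ ∘ f = (Submodule.mapQ U V.1 f hUV) ∘ U.mkQ := by
    ext x
    simp
  rw [h1]
  exact @Continuous.comp _ _ _ (TopologicalSpace.induced _ ⊥) _ _ _ _
    continuous_of_discreteTopology continuous_induced_dom

theorem linTopology_isOpen_of_mem {B : Set (Submodule R M)} {V : Submodule R M} (hV : V ∈ B) :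
    IsOpen[linTopology B] (V : Set M) := by
  refine (iInf_le (fun U : B => TopologicalSpace.induced (U.1.mkQ) ⊥) ⟨V, hV⟩) _ ?_
  refine ⟨{0}, trivial, ?_⟩
  ext x
  simp

/-- An infimum of topologies has finite intersections as basic neighbourhoods; directedness replaces
these by single members of `B`. -/
theorem linTopology_exists_le {B : Set (Submodule R M)} (hB : B.Nonempty)
    (hd : DirectedOn (· ≥ ·) B) {O : Set M} (hO : IsOpen[linTopology B] O) {x : M} (hx : x ∈ O) :
    ∃ V ∈ B, ∀ y, y - x ∈ V → y ∈ O := by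
  have : Nonempty B := hB.to_subtype
  have hO' : O ∈ @nhds M (linTopology B) x :=
    @IsOpen.mem_nhds M (linTopology B) x O hO hx
  rw [nhds_iInf] at hO'
  have key (U : Submodule R M) :
      @nhds M (TopologicalSpace.induced U.mkQ ⊥) x = Filter.principal {y | y - x ∈ U} := by
    let _ : TopologicalSpace (M ⧸ U) := ⊥
    have : DiscreteTopology (M ⧸ U) := ⟨rfl⟩
    rw [nhds_induced, nhds_discrete, ← Filter.principal_singleton, Filter.comap_principal]
    congr 1
    ext y
    simp [Submodule.Quotient.eq]
  simp only [key] at hO'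
  rw [Filter.mem_iInf_of_directed] at hO'
  · obtain ⟨⟨V, hV⟩, h⟩ := hO'
    exact ⟨V, hV, fun y hy => h hy⟩
  · rintro ⟨U, hU⟩ ⟨V, hV⟩
    obtain ⟨W, hW, h1, h2⟩ := hd U hU V hV
    exact ⟨⟨W, hW⟩, Filter.principal_mono.2 fun y hy => h1 hy,
      Filter.principal_mono.2 fun y hy => h2 hy⟩

theorem linTopology_le_of_le {B B' : Set (Submodule R M)} (h : ∀ V ∈ B', ∃ U ∈ B, U ≤ V) :
    linTopology B ≤ linTopology B' :=
  continuous_id_iff_le.1 (linTopology_continuous_of_le B B' LinearMap.id h)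

end LinearTopologies

section LaurentTopology

variable (R : Type v) [CommRing R]

/-- The submodule `tⁿ R⟦t⟧` of the Laurent series. -/
def laurentGE (n : ℤ) : Submodule R (LaurentSeries R) where
  carrier := {f | ∀ k < n, f.coeff k = 0}
  zero_mem' := fun _ _ => rfl
  add_mem' {f g} hf hg := fun k hk => by
    rw [HahnSeries.coeff_add, hf k hk, hg k hk, add_zero]
  smul_mem' r f hf := fun k hk => by
    rw [HahnSeries.coeff_smul, hf k hk, smul_zero]

/-- The submodules generating the `t`-adic topology. -/
def laurentBasis : Set (Submodule R (LaurentSeries R)) :=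
  {U | ∃ n : ℤ, ∀ f : LaurentSeries R, f ∈ U ↔ ∀ k < n, f.coeff k = 0}

theorem laurentGE_mem (n : ℤ) : laurentGE R n ∈ laurentBasis R := ⟨n, fun _ => Iff.rfl⟩

variable {R}

theorem mem_laurentBasis {U : Submodule R (LaurentSeries R)} (hU : U ∈ laurentBasis R) :
    ∃ n, U = laurentGE R n := hU.imp fun _ hn => SetLike.ext hn

theorem laurentGE_anti {m n : ℤ} (h : m ≤ n) : laurentGE R n ≤ laurentGE R m :=
  fun _ hf k hk => hf k (hk.trans_le h)

theorem laurentBasis_nonempty : (laurentBasis R).Nonempty := ⟨_, laurentGE_mem R 0⟩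

theorem laurentBasis_directed : DirectedOn (· ≥ ·) (laurentBasis R) := by
  intro U hU V hV
  obtain ⟨m, rfl⟩ := mem_laurentBasis hU
  obtain ⟨n, rfl⟩ := mem_laurentBasis hV
  exact ⟨_, laurentGE_mem R (max m n), laurentGE_anti (le_max_left _ _),
    laurentGE_anti (le_max_right _ _)⟩

end LaurentTopology

/-! ### The realization of the Tate object of Laurent series -/

section Realization

open ProjFG

variable {R : Type v} [CommRing R]

/-- The pro-object `R`, in the opposite category. -/
abbrev unitPro (R : Type v) [CommRing R] : ProjProOp R := (ProjPro.const (unit R)).unop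

/-- The values of the Tate object `R((t))` at `R` are the Laurent series over `R`. -/
def laurentEquiv : (laurentTate R).obj (unitPro R) ≃ₗ[R] LaurentSeries R where
  toFun x := HahnSeries.ofSuppBddBelow (fun k => endUnitEquiv R (x.1 k)) <| by
    obtain ⟨n, hn⟩ := x.2
    refine ⟨n, fun k hk => ?_⟩
    by_contra! h
    exact hk ((congrArg (endUnitEquiv R) (hn k h)).trans (map_zero _))
  map_add' x y := by
    ext k
    exact map_add (endUnitEquiv R) (x.1 k) (y.1 k)
  map_smul' r x := by
    ext k
    exact map_smul (endUnitEquiv R) r (x.1 k)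
  invFun f := ⟨fun k => (endUnitEquiv R).symm (f.coeff k), f.order, fun k hk =>
    (congrArg (endUnitEquiv R).symm (HahnSeries.coeff_eq_zero_of_lt_order hk)).trans (map_zero _)⟩
  left_inv x := Subtype.ext (funext fun k => (endUnitEquiv R).symm_apply_apply (x.1 k))
  right_inv f := by
    ext k
    exact (endUnitEquiv R).apply_symm_apply _

/-- The morphism `Hom(R, -) ⟶ F` given by an element of `F(R)`. -/
def elementHom {F : ProjProOp R} (y : F.obj.obj (unit R)) : unitPro R ⟶ F :=
  ObjectProperty.homMk
    { app := fun A => ModuleCat.ofHom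
        { toFun := fun φ => F.obj.map φ y
          map_add' := fun φ ψ => by rw [F.obj.map_add]; rfl
          map_smul' := fun r φ => by rw [F.obj.map_smul]; rfl }
      naturality := fun A B f => by
        ext φ
        exact map_comp_apply' φ f y }

theorem elementHom_comp_eq_zero_iff {F : ProjProOp R} (y : F.obj.obj (unit R))
    (h : F ⟶ unitPro R) : elementHom y ≫ h = 0 ↔ h.hom.app (unit R) y = 0 := by
  constructor
  · intro h0
    have := congrArg (fun f => f.hom.app (unit R) (𝟙 (unit R))) h0
    change h.hom.app (unit R) (F.obj.map (𝟙 _) y) = 0 at this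
    rwa [map_id_apply'] at this
  · intro h0
    ext1
    refine natTrans_ext_unit (F := (unitPro R).obj) fun φ => ?_
    obtain ⟨φ, rfl⟩ : ∃ φ' : unit R ⟶ unit R, φ' = φ := ⟨φ, rfl⟩
    change h.hom.app (unit R) (F.obj.map φ y) = 0
    rw [map_end_apply, map_smul, h0, smul_zero]

/-- An element of `X.unop.obj.obj (unit R)` is a morphism from `X` to the constant pro-object `R`,
and the set in question is the kernel it induces. -/
theorem isOpen_proTopology_apply_eq_zero {X : ProjPro R} (y : X.unop.obj.obj (unit R)) :
    IsOpen[proTopology X] {h : X.unop ⟶ unitPro R | h.hom.app (unit R) y = 0} := by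
  have : {h : X.unop ⟶ unitPro R | h.hom.app (unit R) y = 0} =
      (LinearMap.ker (Linear.leftComp R (unitPro R) (elementHom y)) : Set (X.unop ⟶ unitPro R)) := by
    ext h
    exact (elementHom_comp_eq_zero_iff y h).symm
  rw [this]
  exact linTopology_isOpen_of_mem ⟨unit R, (elementHom y).op, rfl⟩

/-- A Laurent family over `X` vanishes below some `N`, so landing in `tⁿ R⟦t⟧` imposes only the
finitely many open conditions in degrees `N ≤ k < n`. -/
theorem laurentGE_comap_mem (n : ℤ) :
    (laurentGE R n).comap (laurentEquiv (R := R)).toLinearMap ∈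
      realizationBasis (laurentTate R) := by
  intro X x
  obtain ⟨⟨x, N, hN⟩, rfl⟩ : ∃ y : laurentSubmodule R (X.unop.obj.obj (unit R)), y = x := ⟨x, rfl⟩
  have : {h : X.unop ⟶ unitPro R | (laurentTate R).map h ⟨x, N, hN⟩ ∈
      (laurentGE R n).comap (laurentEquiv (R := R)).toLinearMap} =
      ⋂ k ∈ Finset.Ico N n, {h : X.unop ⟶ unitPro R | h.hom.app (unit R) (x k) = 0} := by
    ext h
    simp only [Set.mem_iInter, Set.mem_ofPred_eq, Finset.mem_Ico]
    have h1 (k : ℤ) : (laurentEquiv ((laurentTate R).map h ⟨x, N, hN⟩)).coeff k = 0 ↔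
        h.hom.app (unit R) (x k) = 0 := (endUnitEquiv R).map_eq_zero_iff
    refine ⟨fun hh k hk => (h1 k).1 (hh k hk.2), fun hh k hk => (h1 k).2 ?_⟩
    by_cases hkN : N ≤ k
    · exact hh k ⟨hkN, hk⟩
    · rw [hN k (by omega)]
      exact map_zero _
  rw [this]
  let _ := proTopology X
  exact isOpen_biInter_finset fun k _ => isOpen_proTopology_apply_eq_zero (x k)

/-- The linear forms on `R^{(ℕ)}` which vanish at the first `n` basis vectors. -/
def vanishingForms (R : Type v) [CommRing R] (n : ℕ) : Submodule R (finsuppPro R ⟶ unitPro R) where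
  carrier := {h | ∀ k < n, h.hom.app (unit R) (finsuppBasis (k : ℤ)) = 0}
  zero_mem' := fun _ _ => rfl
  add_mem' {f g} hf hg := fun k hk => by
    have : (f.hom.app (unit R) (finsuppBasis (k : ℤ)) : (unitPro R).obj.obj (unit R)) +
      g.hom.app (unit R) (finsuppBasis (k : ℤ)) = 0 := by rw [hf k hk, hg k hk, add_zero]
    exact this
  smul_mem' r f hf := fun k hk => by
    have : r • (f.hom.app (unit R) (finsuppBasis (k : ℤ)) : (unitPro R).obj.obj (unit R)) = 0 := by
      rw [hf k hk, smul_zero]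
    exact this

theorem vanishingForms_anti {m n : ℕ} (h : m ≤ n) : vanishingForms R n ≤ vanishingForms R m :=
  fun _ hf k hk => hf k (hk.trans_le h)

theorem apply_eq_zero_of_basis {M : Type*} [AddCommGroup M] [Module R M]
    (f : (ℕ →₀ (unit R).1) →ₗ[R] M) {n : ℕ} (hf : ∀ k < n, f (finsuppBasis (k : ℤ)) = 0)
    (z : ℕ →₀ (unit R).1) (hz : ∀ k, n ≤ k → z k = 0) : f z = 0 := by
  have : f = finsuppLift fun k => f (finsuppBasis (k : ℤ)) :=
    finsuppUnit_hom_ext fun k => by rw [finsuppLift_basis]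
  rw [this, finsuppLift, Finsupp.lsum_apply]
  refine Finset.sum_eq_zero fun k _ => ?_
  change unitEquiv R (z k) • f (finsuppBasis (k : ℤ)) = 0
  by_cases h : k < n
  · rw [hf k h, smul_zero]
  · rw [hz k (by omega), map_zero, zero_smul]

/-- By Yoneda, a morphism from `"lim" Rⁿ` to `P` is a finitely supported sequence in `P`; its kernel
contains every form vanishing on the basis vectors up to the end of the support. -/
theorem linTopology_vanishingForms_le :
    linTopology (Set.range (vanishingForms R)) ≤ proTopology (op (finsuppPro R)) := by
  refine linTopology_le_of_le ?_
  rintro _ ⟨P, q, rfl⟩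
  obtain ⟨z, hz⟩ : ∃ z : ℕ →₀ P.1, z = q.unop.hom.app P (𝟙 P) := ⟨_, rfl⟩
  obtain ⟨n, hn⟩ := exists_bound z
  refine ⟨_, ⟨n, rfl⟩, fun h hh => ?_⟩
  change q.unop ≫ h = 0
  ext1
  refine natTrans_ext_unit (F := (ProjPro.const P).unop.obj) fun φ => ?_
  obtain ⟨φ, rfl⟩ : ∃ φ' : P ⟶ unit R, φ' = φ := ⟨φ, rfl⟩
  have h1 : q.unop.hom.app (unit R) φ = (finsuppFunctor R).map φ z := by
    rw [hz]
    refine Eq.trans ?_ (nat_apply q.unop.hom φ (𝟙 P))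
    exact congrArg (q.unop.hom.app (unit R)) (Category.id_comp φ).symm
  change h.hom.app (unit R) (q.unop.hom.app (unit R) φ) = 0
  rw [h1]
  refine apply_eq_zero_of_basis (h.hom.app (unit R)).hom hh _ fun k hk => ?_
  change φ.hom (z k) = 0
  rw [hn k hk]
  exact map_zero _

/-- It suffices to test openness on the single pro-object `R⟦t⟧`: every power series is the image of
its universal element under some morphism to the unit. -/
theorem exists_laurentGE_le {V : Submodule R ((laurentTate R).obj (unitPro R))}
    (hV : V ∈ realizationBasis (laurentTate R)) :
    ∃ U ∈ laurentBasis R, U ≤ V.comap (laurentEquiv (R := R)).symm.toLinearMap := by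
  let x : laurentSubmodule R ((finsuppPro R).obj.obj (unit R)) :=
    ⟨finsuppBasis, 0, fun k hk => finsuppBasis_eq_zero hk⟩
  have hO : IsOpen[linTopology (Set.range (vanishingForms R))]
      {h : finsuppPro R ⟶ unitPro R | (laurentTate R).map h x ∈ V} :=
    linTopology_vanishingForms_le _ (hV (op (finsuppPro R)) x)
  obtain ⟨_, ⟨n, rfl⟩, h⟩ := linTopology_exists_le (Set.range_nonempty _) (by
    rintro _ ⟨a, rfl⟩ _ ⟨b, rfl⟩
    exact ⟨_, ⟨max a b, rfl⟩, vanishingForms_anti (le_max_left _ _),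
      vanishingForms_anti (le_max_right _ _)⟩) hO (x := 0) (by
        have : (laurentTate R).map (0 : finsuppPro R ⟶ unitPro R) x = 0 := rfl
        rw [Set.mem_ofPred_eq, this]
        exact V.zero_mem)
  refine ⟨_, laurentGE_mem R n, fun f hf => ?_⟩
  obtain ⟨φ, hφ⟩ := exists_finsuppPro_hom (F := unitPro R)
    fun k : ℕ => (endUnitEquiv R).symm (f.coeff k)
  have h1 : (laurentTate R).map φ x = (laurentEquiv (R := R)).symm f := by
    refine Subtype.ext (funext fun k => ?_)
    change φ.hom.app (unit R) (finsuppBasis k) = (endUnitEquiv R).symm (f.coeff k)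
    by_cases hk : 0 ≤ k
    · obtain ⟨k, rfl⟩ := Int.eq_ofNat_of_zero_le hk
      exact hφ k
    · rw [finsuppBasis_eq_zero (by omega), hf k (by omega)]
      exact (map_zero _).trans (map_zero _).symm
  change (laurentEquiv (R := R)).symm f ∈ V
  rw [← h1]
  refine h φ fun k hk => ?_
  rw [sub_zero]
  refine (hφ k).trans ?_
  rw [hf k (by omega)]
  exact map_zero _

/-- The realization of the Tate object `R((t))` is the topological module `R((t))`. -/
def realizationLaurentIso (R : Type v) [CommRing R] [TopologicalSpace R] [DiscreteTopology R] :
    (tateRealization R).obj (laurentTate R) ≅ laurentTop R where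
  hom := ConcreteCategory.ofHom (C := TopModuleCat.{v} R)
    { toLinearMap := laurentEquiv.toLinearMap
      cont := linTopology_continuous_of_le (realizationBasis (laurentTate R)) (laurentBasis R)
        laurentEquiv.toLinearMap fun V hV => by
          obtain ⟨n, rfl⟩ := mem_laurentBasis hV
          exact ⟨_, laurentGE_comap_mem n, le_rfl⟩ }
  inv := ConcreteCategory.ofHom (C := TopModuleCat.{v} R)
    { toLinearMap := laurentEquiv.symm.toLinearMap
      cont := linTopology_continuous_of_le (laurentBasis R) (realizationBasis (laurentTate R))
        laurentEquiv.symm.toLinearMap fun V hV => exists_laurentGE_le hV }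
  hom_inv_id := by
    ext x
    exact laurentEquiv.symm_apply_apply x
  inv_hom_id := by
    ext x
    exact laurentEquiv.apply_symm_apply x

end Realization

end

/-! ### Continuous endomorphisms of Laurent series lift to the Tate object -/

section

section Endomorphisms

open ProjFG

variable {R : Type v} [CommRing R]

/-- The universal element of `t⁻ⁿ R⟦t⟧`. -/
def laurentUniversal (n : ℕ) : (laurentTate R).obj (finsuppPro R) :=
  (⟨fun k => finsuppBasis (k + n), -n, fun _ hk => finsuppBasis_eq_zero (by omega)⟩ :
    laurentSubmodule R ((finsuppPro R).obj.obj (unit R)))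

theorem exists_eq_map_laurentUniversal {F : ProjProOp R} (x : (laurentTate R).obj F) :
    ∃ (n : ℕ) (ψ : finsuppPro R ⟶ F), (laurentTate R).map ψ (laurentUniversal n) = x := by
  obtain ⟨h⟩ := nonempty_isColimit_laurentCocone R
  obtain ⟨n, ψ, rfl⟩ := colimit_jointly_surjective h F x
  exact ⟨n, ψ, rfl⟩

/-- A morphism of the Tate object `R((t))` is determined by its effect on Laurent series
over `R`. -/
theorem laurentTate_hom_ext {φ φ' : laurentTate R ⟶ laurentTate R}
    (h : ∀ x, φ.app (unitPro R) x = φ'.app (unitPro R) x) : φ = φ' := by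
  ext F x
  change φ.app F x = φ'.app F x
  obtain ⟨n, ψ, rfl⟩ := exists_eq_map_laurentUniversal x
  rw [NatTrans.naturality_apply φ, NatTrans.naturality_apply φ']
  congr 1
  refine Subtype.ext (funext fun l => Finsupp.ext fun j => ?_)
  -- The coordinate maps are jointly injective on `R^{(ℕ)}`, so evaluation at the universal element
  -- is detected after mapping to the unit.
  let p : finsuppPro R ⟶ unitPro R := ObjectProperty.homMk
    { app := fun A => ModuleCat.ofHom (ofElement ∘ₗ Finsupp.lapply j)
      naturality := fun A B f => by
        ext y : 2
        obtain ⟨y, rfl⟩ : ∃ y' : ℕ →₀ A.1, y' = y := ⟨y, rfl⟩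
        exact (ofElement_comp (y j) f).symm }
  have h1 := h ((laurentTate R).map p (laurentUniversal n))
  rw [NatTrans.naturality_apply φ, NatTrans.naturality_apply φ'] at h1
  exact (homUnitEquiv (unit R)).symm.injective (congrFun (congrArg Subtype.val h1) l)

theorem apply_eq_sum_basis {M : Type*} [AddCommGroup M] [Module R M]
    (f : (ℕ →₀ (unit R).1) →ₗ[R] M) (n : ℕ) (z : ℕ →₀ (unit R).1) (hz : ∀ k, n ≤ k → z k = 0) :
    f z = ∑ k ∈ Finset.range n, unitEquiv R (z k) • f (finsuppBasis (k : ℤ)) := by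
  have : f = finsuppLift fun k => f (finsuppBasis (k : ℤ)) :=
    finsuppUnit_hom_ext fun k => by rw [finsuppLift_basis]
  conv_lhs => rw [this, finsuppLift, Finsupp.lsum_apply]
  refine Finsupp.sum_of_support_subset z (fun k hk => ?_) _ fun k _ => map_zero _
  by_contra h
  exact Finsupp.mem_support_iff.1 hk (hz k (by simpa using h))

variable (f : LaurentSeries R →ₗ[R] LaurentSeries R)

/-- The coefficients of an endomorphism of the Laurent series. -/
def laurentEntry (l k : ℤ) : R := (f (HahnSeries.single k 1)).coeff l

variable {f}

theorem single_mem_laurentGE {m k : ℤ} (h : m ≤ k) (r : R) :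
    HahnSeries.single k r ∈ laurentGE R m := fun j hj =>
  HahnSeries.coeff_single_of_ne (by omega)

/-- By continuity `f` maps some `t^m R⟦t⟧` into `R⟦t⟧`, so columns `k ≥ m` have no entries in
negative degrees. Only the finitely many columns with `-n ≤ k < m` remain. -/
theorem exists_laurentEntry_bound (hf : ∀ n, ∃ m, laurentGE R m ≤ (laurentGE R n).comap f) (n : ℕ) :
    ∃ N : ℤ, ∀ l < N, ∀ k : ℤ, -n ≤ k → laurentEntry f l k = 0 := by
  obtain ⟨m, hm⟩ := hf 0
  obtain ⟨N, hN⟩ := ((Finset.Ico (-n : ℤ) m).image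
    fun k => -(f (HahnSeries.single k 1)).order).exists_le
  refine ⟨min (-N) 0, fun l hl k hk => ?_⟩
  by_cases hkm : k < m
  · refine HahnSeries.coeff_eq_zero_of_lt_order ?_
    have := hN _ (Finset.mem_image_of_mem _ (Finset.mem_Ico.2 ⟨hk, hkm⟩))
    omega
  · exact hm (single_mem_laurentGE (by omega) 1) l (by omega)

/-- Continuity makes every row of the matrix of `f` vanish far to the right and bounds the columns
`k ≥ -n` uniformly from below. These are the two conditions for the rows to form a Laurent family
with values in `R^{(ℕ)}`, that is, a map from `t⁻ⁿ R⟦t⟧` to `R((t))`. -/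
theorem exists_laurentTate_hom (hf : ∀ n, ∃ m, laurentGE R m ≤ (laurentGE R n).comap f) :
    ∃ φ : laurentTate R ⟶ laurentTate R,
      ∀ x, laurentEquiv (φ.app (unitPro R) x) = f (laurentEquiv x) := by
  have hf' (l : ℤ) : ∃ m, ∀ g ∈ laurentGE R m, (f g).coeff l = 0 := by
    obtain ⟨m, hm⟩ := hf (l + 1)
    exact ⟨m, fun g hg => hm hg l (by omega)⟩
  choose K hK using hf'
  let z (n : ℕ) : laurentSubmodule R ((finsuppPro R).obj.obj (unit R)) :=
    ⟨fun l => Finsupp.onFinset (Finset.range (K l + n).toNat)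
      (fun j => (unitEquiv R).symm (laurentEntry f l (j - n))) fun j hj => by
        rw [Finset.mem_range]
        by_contra! h
        refine hj ?_
        rw [laurentEntry, hK l _ (single_mem_laurentGE (by omega) 1), map_zero], by
      obtain ⟨N, hN⟩ := exists_laurentEntry_bound hf n
      refine ⟨N, fun l hl => Finsupp.ext fun j => ?_⟩
      exact (congrArg (unitEquiv R).symm (hN l hl (j - n) (by omega))).trans (map_zero _)⟩
  let c : Cocone (laurentSystem R ⋙ linearCoyoneda R (ProjProOp R)) :=
    { pt := laurentTate R
      ι := NatTrans.ofSequence (fun n => laurentYoneda (z n)) fun n => by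
        ext G φ : 4
        obtain ⟨φ, rfl⟩ : ∃ φ' : finsuppPro R ⟶ G, φ' = φ := ⟨φ, rfl⟩
        refine Subtype.ext (funext fun l => ?_)
        refine congrArg (φ.hom.app (unit R)) (Finsupp.ext fun j => ?_)
        change (unitEquiv R).symm (laurentEntry f l (((j + (n + 1 - n) : ℕ) : ℤ) - (n + 1 : ℕ))) =
          (unitEquiv R).symm (laurentEntry f l (j - n))
        congr 2
        omega }
  obtain ⟨hL⟩ := nonempty_isColimit_laurentCocone R
  refine ⟨hL.desc c, fun x => ?_⟩
  obtain ⟨n, ψ, rfl⟩ := exists_eq_map_laurentUniversal x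
  have h1 : (hL.desc c).app (unitPro R) ((laurentTate R).map ψ (laurentUniversal n)) =
      (laurentTate R).map ψ (z n) :=
    congrArg (fun f => f.app (unitPro R) ψ) (hL.fac c n)
  refine (congrArg laurentEquiv h1).trans ?_
  ext l
  set g := laurentEquiv ((laurentTate R).map ψ (laurentUniversal n))
  have hgc (k : ℤ) : g.coeff k =
    endUnitEquiv R (ψ.hom.app (unit R) (finsuppBasis (k + n))) := rfl
  let J : ℕ := (K l + n).toNat
  let b : (ℕ →₀ (unit R).1) →ₗ[R] R :=
    (endUnitEquiv R).toLinearMap ∘ₗ (ψ.hom.app (unit R)).hom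
  have hb (j : ℕ) : b (finsuppBasis j) = g.coeff (j - n) := by
    rw [hgc, sub_add_cancel]
    rfl
  -- The part of `g` in degrees below `K l`; the remainder does not affect the `l`-th coefficient of
  -- `f g`, and on a finite sum `f` is computed by its matrix.
  let s : LaurentSeries R := ∑ j ∈ Finset.range J, HahnSeries.single (j - n : ℤ) (g.coeff (j - n))
  have h3 : g - s ∈ laurentGE R (K l) := by
    intro k hk
    rw [HahnSeries.coeff_sub, HahnSeries.coeff_sum]
    by_cases hkn : -n ≤ k
    · rw [Finset.sum_eq_single (k + n).toNat]
      · rw [show (((k + n).toNat : ℤ) - n) = k by omega, HahnSeries.coeff_single_same, sub_self]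
      · exact fun j _ hj => HahnSeries.coeff_single_of_ne (by omega)
      · intro h
        simp only [J, Finset.mem_range] at h
        omega
    · rw [Finset.sum_eq_zero fun j _ => HahnSeries.coeff_single_of_ne (by omega), hgc,
        finsuppBasis_eq_zero (by omega), sub_zero]
      exact (congrArg (endUnitEquiv R) (map_zero (ψ.hom.app (unit R)).hom)).trans (map_zero _)
  have h4 : (f g).coeff l = (f s).coeff l := by
    have := hK l _ h3
    rwa [map_sub, HahnSeries.coeff_sub, sub_eq_zero] at this
  rw [h4, map_sum, HahnSeries.coeff_sum]
  change b ((z n).1 l) = _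
  refine (apply_eq_sum_basis b J _ fun j hj => ?_).trans (Finset.sum_congr rfl fun j _ => ?_)
  · refine (congrArg (unitEquiv R).symm ?_).trans (map_zero _)
    exact hK l _ (single_mem_laurentGE (by omega) 1)
  · have h5 : HahnSeries.single (j - n : ℤ) (g.coeff (j - n)) =
        g.coeff (j - n) • HahnSeries.single (j - n : ℤ) (1 : R) := by
      ext k
      rw [HahnSeries.coeff_smul, HahnSeries.coeff_single, HahnSeries.coeff_single]
      split_ifs <;> simp
    rw [h5, map_smul, HahnSeries.coeff_smul, hb, smul_eq_mul, smul_eq_mul, mul_comm]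
    congr 1
    exact (unitEquiv R).apply_symm_apply _

end Endomorphisms

end

/-! ### Condensed maps between sequential topological modules -/

section

section FirstCountable

variable {R : Type v} [CommRing R]

theorem linTopology_firstCountableTopology {M : Type v} [AddCommGroup M] [Module R M]
    {B : Set (Submodule R M)} (hB : B.Countable) :
    @FirstCountableTopology M (linTopology B) := by
  have : Countable B := hB.to_subtype
  refine @FirstCountableTopology.mk M (linTopology B) fun x => ?_
  rw [nhds_iInf]
  have (U : B) : (@nhds M (TopologicalSpace.induced U.1.mkQ ⊥) x).IsCountablyGenerated := by
    let _ : TopologicalSpace (M ⧸ U.1) := ⊥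
    have : DiscreteTopology (M ⧸ U.1) := ⟨rfl⟩
    rw [nhds_induced, nhds_discrete, ← Filter.principal_singleton, Filter.comap_principal]
    infer_instance
  infer_instance

theorem laurentBasis_countable : (laurentBasis R).Countable :=
  (Set.countable_range (laurentGE R)).mono fun _ hU =>
    (mem_laurentBasis hU).imp fun _ hn => hn.symm

instance [TopologicalSpace R] [DiscreteTopology R] : FirstCountableTopology (laurentTop R) :=
  linTopology_firstCountableTopology laurentBasis_countable

end FirstCountable

namespace TopModuleCat

variable {R : Type (u + 1)} [CommRing R] [TopologicalSpace R]

/-- The one-point space. -/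
abbrev point : CompHaus.{u} := CompHaus.of PUnit.{u + 1}

/-- The map from the one-point space given by a point. -/
def pointMap {S : CompHaus.{u}} (s : S) : point.{u} ⟶ S :=
  CompHausLike.ofHom _ (ContinuousMap.const PUnit s)

/-- Evaluation of sections at a point. -/
def evalAt {Y : TopModuleCat.{u + 1} R} {S : CompHaus.{u}} (s : S) :
    ((toCondensed.{u} R).obj Y).obj.obj (op S) →ₗ[R] Y where
  toFun g := DFunLike.coe (F := C(S, Y)) g s
  map_add' _ _ := rfl
  map_smul' _ _ := rfl

/-- The map on points induced by a map of presheaves into the condensed module of a topological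
module. -/
def onPoints {F : CompHaus.{u}ᵒᵖ ⥤ ModuleCat.{u + 1} R} {Y : TopModuleCat.{u + 1} R}
    (e : F ⟶ ((toCondensed.{u} R).obj Y).obj) : F.obj (op point.{u}) →ₗ[R] Y :=
  evalAt PUnit.unit ∘ₗ (e.app (op point.{u})).hom

/-- Naturality along the inclusion of a point: a map into a condensed module of continuous functions
is determined pointwise. -/
theorem onPoints_apply {F : CompHaus.{u}ᵒᵖ ⥤ ModuleCat.{u + 1} R} {Y : TopModuleCat.{u + 1} R}
    (e : F ⟶ ((toCondensed.{u} R).obj Y).obj) {S : CompHaus.{u}} (x : F.obj (op S)) (s : S) :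
    evalAt s (e.app (op S) x) = onPoints e (F.map (pointMap s).op x) := by
  have h := NatTrans.naturality_apply e (pointMap s).op x
  exact (congrArg (evalAt PUnit.unit) h).symm

theorem hom_ext_onPoints {F : CompHaus.{u}ᵒᵖ ⥤ ModuleCat.{u + 1} R} {Y : TopModuleCat.{u + 1} R}
    {e e' : F ⟶ ((toCondensed.{u} R).obj Y).obj} (h : ∀ x, onPoints e x = onPoints e' x) :
    e = e' := by
  ext S x
  refine ContinuousMap.ext fun s => ?_
  exact (onPoints_apply e x s).trans ((h _).trans (onPoints_apply e' x s).symm)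

/-- A morphism of condensed modules between sequential topological modules is induced by a
continuous map. -/
theorem exists_toCondensed_map_eq {X Y : TopModuleCat.{u + 1} R} [SequentialSpace X]
    (e : (toCondensed.{u} R).obj X ⟶ (toCondensed.{u} R).obj Y) :
    ∃ φ : X ⟶ Y, (toCondensed.{u} R).map φ = e := by
  let c : X →ₗ[R] ((toCondensed.{u} R).obj X).obj.obj (op point.{u}) :=
    { toFun := fun x => (ContinuousMap.const PUnit x : C(PUnit.{u + 1}, X))
      map_add' := fun _ _ => rfl
      map_smul' := fun _ _ => rfl }
  let f : X →ₗ[R] Y := onPoints e.hom ∘ₗ c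
  have hf {S : CompHaus.{u}} (g : C(S, X)) (s : S) :
      evalAt s (e.hom.app (op S) g) = f (g s) := onPoints_apply e.hom g s
  have hcont : Continuous f := by
    refine continuous_iff_seqContinuous.2 fun x a hx => ?_
    -- A convergent sequence is a continuous map from the compact space `ℕ ∪ {∞}`, hence a section
    -- to which `e` applies; the resulting section of `Y` is continuous at infinity.
    let g : C(OnePoint ℕ, X) := OnePoint.continuousMapMkNat x a hx
    let S : CompHaus.{u} := CompHaus.of (ULift.{u} (OnePoint ℕ))
    let g' : C(S, X) := g.comp ⟨ULift.down, continuous_uliftDown⟩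
    let k : C(S, Y) := e.hom.app (op S) g'
    have hk : f ∘ g = k ∘ ULift.up := funext fun n => (hf g' (ULift.up n)).symm
    have h1 : Continuous (f ∘ g) := by
      rw [hk]
      exact k.continuous.comp continuous_uliftUp
    exact (OnePoint.continuous_iff_from_nat _).1 h1
  refine ⟨ConcreteCategory.ofHom (C := TopModuleCat.{u + 1} R) { toLinearMap := f, cont := hcont },
    ?_⟩
  ext S g
  refine ContinuousMap.ext fun s => ?_
  exact (hf g s).symm

end TopModuleCat

end

/-! ### Measures on profinite sets and functionals on integer valued functions -/

section

section Integration

variable {R : Type v} [CommRing R] {S : Type u} [TopologicalSpace S]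

/-- A compatible family of measures on the discrete quotients of a space. -/
def IsCompatibleFamily (μ : ∀ i : DiscreteQuotient S, i →₀ R) : Prop :=
  ∀ (i j : DiscreteQuotient S) (hij : i ≤ j),
    Finsupp.mapDomain (DiscreteQuotient.ofLE hij) (μ i) = μ j

/-- The integral of a locally constant function. -/
def integral (μ : ∀ i : DiscreteQuotient S, i →₀ R) (f : LocallyConstant S R) : R :=
  Finsupp.linearCombination R f.lift (μ f.discreteQuotient)

/-- Both sides can be computed on a common refinement of the two quotients. Thus the integral may be
taken over any quotient through which `f` factors. -/
theorem IsCompatibleFamily.integral_eq {μ : ∀ i : DiscreteQuotient S, i →₀ R}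
    (hμ : IsCompatibleFamily μ) {f : LocallyConstant S R} {i : DiscreteQuotient S} {g : i → R}
    (h : ∀ s, f s = g (i.proj s)) : integral μ f = Finsupp.linearCombination R g (μ i) := by
  rw [integral, ← hμ (i ⊓ f.discreteQuotient) i inf_le_left,
    ← hμ (i ⊓ f.discreteQuotient) f.discreteQuotient inf_le_right,
    Finsupp.linearCombination_mapDomain, Finsupp.linearCombination_mapDomain]
  congr 2
  funext a
  obtain ⟨s, rfl⟩ := (i ⊓ f.discreteQuotient).proj_surjective a
  simp only [Function.comp_apply, DiscreteQuotient.ofLE_proj]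
  rw [← h]
  exact congrFun f.lift_comp_proj s

/-- Integration, as a linear map. -/
def IsCompatibleFamily.integralHom {μ : ∀ i : DiscreteQuotient S, i →₀ R}
    (hμ : IsCompatibleFamily μ) : LocallyConstant S R →ₗ[R] R where
  toFun := integral μ
  map_add' f g := by
    have key (h : LocallyConstant S R) {i : DiscreteQuotient S} (hi : i ≤ h.discreteQuotient)
      (s : S) : h s = h.lift (DiscreteQuotient.ofLE hi (i.proj s)) := by
      rw [DiscreteQuotient.ofLE_proj]
      rfl
    let k := f.discreteQuotient ⊓ g.discreteQuotient
    rw [hμ.integral_eq (i := k) (g := fun a => f.lift (DiscreteQuotient.ofLE inf_le_left a))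
        (key f inf_le_left),
      hμ.integral_eq (i := k) (g := fun a => g.lift (DiscreteQuotient.ofLE inf_le_right a))
        (key g inf_le_right),
      hμ.integral_eq (i := k) (g := (fun a => f.lift (DiscreteQuotient.ofLE inf_le_left a)) +
          fun a => g.lift (DiscreteQuotient.ofLE inf_le_right a))
        fun s => congrArg₂ (· + ·) (key f inf_le_left s) (key g inf_le_right s)]
    simp [Finsupp.linearCombination_apply, Finsupp.sum, mul_add, Finset.sum_add_distrib]
  map_smul' r f := by
    rw [hμ.integral_eq (i := f.discreteQuotient) (g := r • f.lift) fun s => rfl, integral]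
    simp [Finsupp.linearCombination_apply, Finsupp.sum, Finset.mul_sum, mul_left_comm]

/-- Integration of integer valued functions. -/
def IsCompatibleFamily.functional {μ : ∀ i : DiscreteQuotient S, i →₀ R}
    (hμ : IsCompatibleFamily μ) : LocallyConstant S ℤ →ₗ[ℤ] R :=
  (hμ.integralHom.toAddMonoidHom.comp
    (LocallyConstant.mapAddMonoidHom (Int.castAddHom R))).toIntLinearMap

theorem IsCompatibleFamily.functional_apply {μ : ∀ i : DiscreteQuotient S, i →₀ R}
    (hμ : IsCompatibleFamily μ) (f : LocallyConstant S ℤ) :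
    hμ.functional f = integral μ (f.map Int.cast) := rfl

theorem IsCompatibleFamily.functional_mem {μ : ∀ i : DiscreteQuotient S, i →₀ R}
    (hμ : IsCompatibleFamily μ) {A : Subring R} (hA : ∀ i a, μ i a ∈ A)
    (f : LocallyConstant S ℤ) : hμ.functional f ∈ A := by
  rw [hμ.functional_apply, hμ.integral_eq (i := f.discreteQuotient)
    (g := fun a => ((f.lift a : ℤ) : R)) fun s => rfl, Finsupp.linearCombination_apply]
  exact sum_mem fun a _ => mul_mem (hA _ _) (intCast_mem _ _)

open Classical in
/-- The indicator function of a fibre of a discrete quotient. -/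
def fiberIndicator (i : DiscreteQuotient S) (a : i) : LocallyConstant S ℤ :=
  (⟨i.proj, i.proj_isLocallyConstant⟩ : LocallyConstant S i).map fun b => if b = a then 1 else 0

open Classical in
theorem fiberIndicator_apply (i : DiscreteQuotient S) (a : i) (s : S) :
    fiberIndicator i a s = if i.proj s = a then 1 else 0 := rfl

theorem IsCompatibleFamily.functional_fiberIndicator {μ : ∀ i : DiscreteQuotient S, i →₀ R}
    (hμ : IsCompatibleFamily μ) (i : DiscreteQuotient S) (a : i) :
    hμ.functional (fiberIndicator i a) = μ i a := by
  classical
  rw [hμ.functional_apply, hμ.integral_eq (i := i) (g := fun b => if b = a then 1 else 0)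
    fun s => by
      rw [LocallyConstant.map_apply, Function.comp_apply, fiberIndicator_apply]
      split_ifs <;> simp]
  simp only [Finsupp.linearCombination_apply, smul_eq_mul, mul_ite, mul_one, mul_zero,
    Finsupp.sum_ite_self_eq']

variable [CompactSpace S]

/-- The compatible family attached to a functional on integer valued locally constant
functions. -/
def familyOfFunctional (Λ : LocallyConstant S ℤ →ₗ[ℤ] R) (i : DiscreteQuotient S) : i →₀ R :=
  Finsupp.equivFunOnFinite.symm fun a => Λ (fiberIndicator i a)

theorem familyOfFunctional_apply (Λ : LocallyConstant S ℤ →ₗ[ℤ] R) (i : DiscreteQuotient S)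
    (a : i) : familyOfFunctional Λ i a = Λ (fiberIndicator i a) := rfl

/-- The indicator of a fibre of the coarser quotient is the sum of the indicators of the finer
fibres it contains. -/
theorem isCompatibleFamily_familyOfFunctional (Λ : LocallyConstant S ℤ →ₗ[ℤ] R) :
    IsCompatibleFamily (familyOfFunctional Λ) := by
  classical
  intro i j hij
  have := Fintype.ofFinite i
  ext b
  have h1 : familyOfFunctional Λ i = ∑ a, Finsupp.single a (Λ (fiberIndicator i a)) :=
    (Finsupp.univ_sum_single _).symm
  rw [h1, Finsupp.mapDomain_finsetSum, Finsupp.finsetSum_apply, familyOfFunctional_apply]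
  simp only [Finsupp.mapDomain_single, Finsupp.single_apply]
  have h2 : fiberIndicator j b =
      ∑ a : i, if DiscreteQuotient.ofLE hij a = b then fiberIndicator i a else 0 := by
    ext s
    have h3 : (∑ a : i, if DiscreteQuotient.ofLE hij a = b then fiberIndicator i a else 0) s =
        ∑ a : i, if DiscreteQuotient.ofLE hij a = b then fiberIndicator i a s else 0 := by
      rw [← LocallyConstant.coeFnAddMonoidHom_apply, map_sum, Finset.sum_apply]
      refine Finset.sum_congr rfl fun a _ => ?_
      split_ifs <;> rfl
    rw [h3, Finset.sum_eq_single (i.proj s)]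
    · simp [fiberIndicator_apply]
    · intro a _ ha
      rw [fiberIndicator_apply, if_neg (Ne.symm ha), ite_self]
    · simp
  rw [h2, map_sum]
  refine Finset.sum_congr rfl fun a _ => ?_
  split_ifs <;> simp

end Integration

/-! ### Linear forms on measures -/

section Solid

variable {R : Type (u + 1)} [CommRing R] {S T : CompHaus.{u}}

theorem solidSections_isCompatibleFamily (x : solidSections R S T) (t : T) :
    IsCompatibleFamily fun i => x.1 i t := fun i j hij => x.2.1 i j hij t

/-- The section of measures attached to a locally constant family of functionals. -/
def sectionOfFunctionals (Λ : T → (LocallyConstant S ℤ →ₗ[ℤ] R))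
    (hΛ : ∀ f, IsLocallyConstant fun t => Λ t f) (s : Finset R)
    (hs : ∀ t f, Λ t f ∈ Subring.closure (s : Set R)) : solidSections R S T :=
  ⟨fun i => ⟨fun t => familyOfFunctional (Λ t) i, by
      refine (IsLocallyConstant.iff_eventually_eq _).2 fun t => ?_
      have h : ∀ᶠ t' in 𝓝 t, ∀ a : i, Λ t' (fiberIndicator i a) = Λ t (fiberIndicator i a) :=
        Filter.eventually_all.2 fun a => (IsLocallyConstant.iff_eventually_eq _).1 (hΛ _) t
      exact h.mono fun t' ht' => Finsupp.ext ht'⟩,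
    fun i j hij t => isCompatibleFamily_familyOfFunctional (Λ t) i j hij,
    s, fun i t a => hs t _⟩

theorem solidSections_ext {x y : solidSections R S T} (h : ∀ i t a, x.1 i t a = y.1 i t a) :
    x = y :=
  Subtype.ext (funext fun i => LocallyConstant.ext fun t => Finsupp.ext fun a => h i t a)

/-- Basic open sets of a product constrain only finitely many coordinates. -/
theorem IsLocallyConstant.exists_finset_of_pi_bool {I α : Type*} {F : (I → Bool) → α}
    (hF : IsLocallyConstant F) (t₀ : I → Bool) :
    ∃ J : Finset I, ∀ t, (∀ i ∈ J, t i = t₀ i) → F t = F t₀ := by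
  obtain ⟨J, U, hU, h⟩ := isOpen_pi_iff.1 (hF {F t₀}) t₀ rfl
  exact ⟨J, fun t ht => h fun i hi => by rw [ht i hi]; exact (hU i hi).2⟩

/-- A linear form on the measures on a profinite set which is locally constant in families is given
by a finite combination of the integrals of basis elements, and hence it is the integration of a
locally constant function. -/
theorem eq_integral_of_isLocallyConstant [TotallyDisconnectedSpace S]
    (ℓ : solidSections R S TopModuleCat.point.{u} →ₗ[R] R)
    (hℓ : ∀ (T : CompHaus.{u}) (x : solidSections R S T), IsLocallyConstant fun t : T =>
      ℓ ((solidPresheaf R S).map (TopModuleCat.pointMap t).op x))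
    (h : LocallyConstant S R)
    (hh : ∀ s : S, ℓ ((solidPresheaf R S).map (TopModuleCat.pointMap s).op (diracSection R S)) =
      h s) (μ : solidSections R S TopModuleCat.point.{u}) :
    ℓ μ = integral (fun i => μ.1 i PUnit.unit) h := by
  classical
  -- Nöbeling's theorem. A functional on a free module is given by arbitrary values on a basis, so
  -- basis vectors can be switched on and off independently.
  have : Module.Free ℤ (LocallyConstant S ℤ) :=
    LocallyConstant.freeOfProfinite (Profinite.of S)
  let I : Type u := Module.Free.ChooseBasisIndex ℤ (LocallyConstant S ℤ)
  let b : Module.Basis I ℤ (LocallyConstant S ℤ) := Module.Free.chooseBasis ℤ (LocallyConstant S ℤ)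
  let Λ (c : I → R) : LocallyConstant S ℤ →ₗ[ℤ] R := b.constr ℤ c
  have hΛ (c : I → R) (f : LocallyConstant S ℤ) :
      Λ c f = ∑ i ∈ (b.repr f).support, (b.repr f i) • c i := b.constr_apply ℤ c f
  have hmem {c : I → R} {A : Subring R} (hc : ∀ i, c i ∈ A) (f : LocallyConstant S ℤ) :
      Λ c f ∈ A := by
    rw [hΛ]
    exact sum_mem fun i _ => zsmul_mem (hc i) _
  have hΛb (c : I → R) (i : I) : Λ c (b i) = c i := b.constr_basis ℤ c i
  let D (c : I → R) (s : Finset R) (hc : ∀ i, c i ∈ Subring.closure (s : Set R)) :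
      solidSections R S TopModuleCat.point.{u} :=
    sectionOfFunctionals (fun _ => Λ c) (fun f => IsLocallyConstant.const _) s
      fun _ => hmem hc
  let cut (c : I → R) (t : I → Bool) (i : I) : R := if t i then c i else 0
  have hcut {c : I → R} {A : Subring R} (hc : ∀ i, c i ∈ A) (t : I → Bool) (i : I) :
      cut c t i ∈ A := by
    simp only [cut]
    split_ifs
    · exact hc i
    · exact zero_mem A
  -- All truncations of `c` form one section over the Cantor cube: its value on any `f` involves
  -- only the finitely many basis elements occurring in `f`, and all coefficients stay in the same
  -- finitely generated subring.
  have hlc (c : I → R) (s : Finset R) (hc : ∀ i, c i ∈ Subring.closure (s : Set R)) :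
      IsLocallyConstant fun t : I → Bool => ℓ (D (cut c t) s (hcut hc t)) := by
    refine hℓ (CompHaus.of (I → Bool)) (sectionOfFunctionals (fun t => Λ (cut c t)) (fun f => ?_) s
      fun t => hmem (hcut hc t))
    refine (IsLocallyConstant.iff_eventually_eq _).2 fun t => ?_
    have h : ∀ᶠ t' in 𝓝 t, ∀ i ∈ (b.repr f).support, t' i = t i := by
      refine (Filter.eventually_all_finset _).2 fun i _ => ?_
      exact (continuous_apply (A := fun _ : I => Bool) i).continuousAt.eventually
        (IsOpen.mem_nhds (isOpen_discrete {t i}) rfl)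
    refine h.mono fun t' ht' => ?_
    rw [hΛ, hΛ]
    exact Finset.sum_congr rfl fun i hi => by simp only [cut, ht' i hi]
  let e (i : I) : solidSections R S TopModuleCat.point.{u} :=
    D (Pi.single i 1) ∅ fun j => by
      rw [Pi.single_apply]
      split_ifs
      · exact one_mem _
      · exact zero_mem _
  have hsum (c : I → R) (s : Finset R) (hc : ∀ i, c i ∈ Subring.closure (s : Set R))
      (J : Finset I) : ℓ (D (cut c fun i => decide (i ∈ J)) s (hcut hc _)) =
        ∑ i ∈ J, c i * ℓ (e i) := by
    have h1 : D (cut c fun i => decide (i ∈ J)) s (hcut hc _) = ∑ i ∈ J, c i • e i := by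
      refine solidSections_ext fun q t a => ?_
      let co : solidSections R S TopModuleCat.point.{u} →ₗ[R] R :=
        { toFun := fun x => x.1 q t a
          map_add' := fun _ _ => rfl
          map_smul' := fun _ _ => rfl }
      have hco (x) : x.1 q t a = co x := rfl
      refine (hco _).trans (Eq.trans ?_ (hco _).symm)
      rw [map_sum]
      simp only [map_smul]
      change Λ _ (fiberIndicator q a) = ∑ i ∈ J, c i • Λ (Pi.single i 1) (fiberIndicator q a)
      have h2 : Λ (cut c fun i => decide (i ∈ J)) = ∑ i ∈ J, c i • Λ (Pi.single i 1) := by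
        refine b.ext fun j => ?_
        rw [hΛb, LinearMap.sum_apply]
        simp only [LinearMap.smul_apply, hΛb, Pi.single_apply, cut, decide_eq_true_eq, smul_eq_mul,
          mul_ite, mul_one, mul_zero, Finset.sum_ite_eq]
      rw [h2, LinearMap.sum_apply]
      rfl
    rw [h1, map_sum]
    simp only [map_smul, smul_eq_mul]
  -- Near the empty subset of the basis, only finitely many coordinates matter, so switching on one
  -- element outside them leaves the value at zero.
  obtain ⟨J₀, hJ₀⟩ : ∃ J₀ : Finset I, ∀ i ∉ J₀, ℓ (e i) = 0 := by
    obtain ⟨J₀, h₀⟩ := (hlc (fun _ => 1) ∅ fun _ => one_mem _).exists_finset_of_pi_bool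
      fun _ => false
    refine ⟨J₀, fun i hi => ?_⟩
    have h1 := h₀ (fun j => decide (j ∈ ({i} : Finset I))) fun j hj => by
      rw [decide_eq_false_iff_not, Finset.mem_singleton]
      rintro rfl
      exact hi hj
    have h2 := hsum (fun _ => 1) ∅ (fun _ => one_mem _) {i}
    have h3 := hsum (fun _ => 1) ∅ (fun _ => one_mem _) ∅
    simp only [Finset.sum_singleton, Finset.sum_empty, one_mul, Finset.notMem_empty,
      decide_false] at h2 h3
    rw [← h2, h1, h3]
  have main (μ : solidSections R S TopModuleCat.point.{u}) : ℓ μ =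
      ∑ i ∈ J₀, (solidSections_isCompatibleFamily μ PUnit.unit).functional (b i) * ℓ (e i) := by
    obtain ⟨s, hs⟩ := μ.2.2
    set hμ := solidSections_isCompatibleFamily μ PUnit.unit
    let c : I → R := fun i => hμ.functional (b i)
    have hc (i : I) : c i ∈ Subring.closure (s : Set R) :=
      hμ.functional_mem (fun i a => hs i PUnit.unit a) _
    have hΛc : Λ (cut c fun _ => true) = hμ.functional := b.ext fun i => by
      rw [hΛb]
      rfl
    have hDc : D (cut c fun _ => true) s (hcut hc _) = μ := by
      refine solidSections_ext fun q t a => ?_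
      change Λ _ (fiberIndicator q a) = _
      rw [hΛc]
      exact hμ.functional_fiberIndicator q a
    -- Near the full subset, `μ` may be replaced by a finite truncation without changing `ℓ`; the
    -- terms outside `J₀` then contribute nothing.
    obtain ⟨J, hJ⟩ := (hlc c s hc).exists_finset_of_pi_bool fun _ => true
    have h1 := hJ (fun i => decide (i ∈ J ∪ J₀)) fun i hi => by
      rw [decide_eq_true_eq]
      exact Finset.mem_union_left _ hi
    rw [hsum c s hc (J ∪ J₀), hDc] at h1
    rw [← h1]
    refine (Finset.sum_subset Finset.subset_union_right fun i _ hi => ?_).symm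
    rw [hJ₀ i hi, mul_zero]
  have hint (μ : solidSections R S TopModuleCat.point.{u}) : ℓ μ =
      integral (fun i => μ.1 i PUnit.unit) (∑ i ∈ J₀, ℓ (e i) • (b i).map (Int.cast : ℤ → R)) := by
    rw [main]
    change _ = (solidSections_isCompatibleFamily μ PUnit.unit).integralHom _
    rw [map_sum]
    refine Finset.sum_congr rfl fun i _ => ?_
    rw [map_smul, mul_comm]
    rfl
  -- The integrand is identified with `h` by evaluating at Dirac measures.
  rw [hint]
  congr 1
  ext s
  refine Eq.trans ?_ ((hint _).symm.trans (hh s))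
  refine Eq.symm ((Finsupp.linearCombination_single R (1 : R) _).trans ?_)
  exact one_smul R _

end Solid

end

/-! ### Solidity of Laurent series -/

section

section LaurentContinuity

variable {R : Type v} [CommRing R] {T : Type*} [TopologicalSpace T]

/-- Given the uniform lower bound `n`, a class modulo `t^m R⟦t⟧` depends only on the finitely many
coefficients in degrees `n ≤ k < m`. -/
theorem continuous_laurent_of_coeff {g : T → LaurentSeries R} (n : ℤ)
    (hn : ∀ t, ∀ k < n, (g t).coeff k = 0) (hg : ∀ k, IsLocallyConstant fun t => (g t).coeff k) :
    Continuous[_, linTopology (laurentBasis R)] g := by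
  refine continuous_iInf_rng.2 fun ⟨U, hU⟩ => continuous_induced_rng.2 ?_
  obtain ⟨m, rfl⟩ := mem_laurentBasis hU
  refine @IsLocallyConstant.continuous _ _ _ (_) _ ?_
  refine (IsLocallyConstant.iff_eventually_eq _).2 fun t => ?_
  have h : ∀ᶠ t' in 𝓝 t, ∀ k ∈ Finset.Ico n m, (g t').coeff k = (g t).coeff k :=
    (Filter.eventually_all_finset _).2 fun k _ =>
      (IsLocallyConstant.iff_eventually_eq _).1 (hg k) t
  refine h.mono fun t' ht' => (Submodule.Quotient.eq _).2 fun k hk => ?_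
  rw [HahnSeries.coeff_sub]
  by_cases hkn : n ≤ k
  · rw [ht' k (Finset.mem_Ico.2 ⟨hkn, hk⟩), sub_self]
  · rw [hn _ _ (by omega), hn _ _ (by omega), sub_self]

theorem eventually_sub_mem_laurentGE {g : T → LaurentSeries R}
    (hg : Continuous[_, linTopology (laurentBasis R)] g) (n : ℤ) (t : T) :
    ∀ᶠ t' in 𝓝 t, g t' - g t ∈ laurentGE R n := by
  have h1 := continuous_induced_rng.1
    (continuous_iInf_rng.1 hg ⟨laurentGE R n, laurentGE_mem R _⟩)
  let _ : TopologicalSpace (LaurentSeries R ⧸ laurentGE R n) := ⊥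
  have : DiscreteTopology (LaurentSeries R ⧸ laurentGE R n) := ⟨rfl⟩
  have h2 : IsLocallyConstant ((laurentGE R n).mkQ ∘ g) :=
    (IsLocallyConstant.iff_continuous _).2 h1
  exact ((IsLocallyConstant.iff_eventually_eq _).1 h2 t).mono fun t' ht' =>
    (Submodule.Quotient.eq _).1 ht'

theorem isLocallyConstant_coeff {g : T → LaurentSeries R}
    (hg : Continuous[_, linTopology (laurentBasis R)] g) (k : ℤ) :
    IsLocallyConstant fun t => (g t).coeff k := by
  refine (IsLocallyConstant.iff_eventually_eq _).2 fun t => ?_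
  refine (eventually_sub_mem_laurentGE hg (k + 1) t).mono fun t' ht' => ?_
  have := ht' k (by omega)
  rwa [HahnSeries.coeff_sub, sub_eq_zero] at this

/-- The open submodules `t⁻ⁿ R⟦t⟧` increase to all of `R((t))`, so one of them contains the compact
image. -/
theorem exists_coeff_bound [CompactSpace T] {g : T → LaurentSeries R}
    (hg : Continuous[_, linTopology (laurentBasis R)] g) :
    ∃ n : ℤ, ∀ t, ∀ k < n, (g t).coeff k = 0 := by
  obtain ⟨n, hn⟩ := isCompact_univ.elim_directed_cover
    (fun n : ℕ => g ⁻¹' (laurentGE R (-n) : Set (LaurentSeries R)))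
    (fun n => @IsOpen.preimage _ _ _ (linTopology (laurentBasis R)) _ hg _
      (linTopology_isOpen_of_mem (laurentGE_mem R _)))
    (fun t _ => Set.mem_iUnion.2 ⟨(-(g t).order).toNat, fun k hk =>
      HahnSeries.coeff_eq_zero_of_lt_order (by omega)⟩)
    (directed_of_isDirected_le fun m n hmn => Set.preimage_mono
      (laurentGE_anti (by omega)))
  exact ⟨-n, fun t => hn (Set.mem_univ t)⟩

end LaurentContinuity

section LaurentSolid

open TopModuleCat

variable {R : Type (u + 1)} [CommRing R]

/-- By the universal property of sheafification, maps out of `R_■[S]` are maps out of the presheaf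
of measures. -/
theorem isSolidMod_of_bijective {M : CondensedMod.{u} R}
    (h : ∀ S : Stonean.{u}, Function.Bijective
      fun φ : solidPresheaf R (Stonean.toCompHaus.obj S) ⟶ M.obj =>
        φ.app (op (Stonean.toCompHaus.obj S)) (diracSection R (Stonean.toCompHaus.obj S))) :
    IsSolidMod.{u} R M := by
  intro S
  have h1 : Function.Bijective fun f : solidFree R (Stonean.toCompHaus.obj S) ⟶ M =>
      toSheafify (coherentTopology CompHaus.{u}) (solidPresheaf R (Stonean.toCompHaus.obj S)) ≫
        f.hom :=
    ((sheafificationAdjunction (coherentTopology CompHaus.{u}) (ModuleCat.{u + 1} R)).homEquiv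
      (solidPresheaf R (Stonean.toCompHaus.obj S)) M).bijective
  exact (h S).comp h1

theorem solidSections_isLocallyConstant_integral {S T : CompHaus.{u}} (x : solidSections R S T)
    (f : LocallyConstant S R) : IsLocallyConstant fun t => integral (fun i => x.1 i t) f :=
  ((x.1 f.discreteQuotient).map (Finsupp.linearCombination R f.lift)).isLocallyConstant

theorem integral_diracSection {S : CompHaus.{u}} (f : LocallyConstant S R) (s : S) :
    integral (fun i => (diracSection R S).1 i s) f = f s := by
  refine (Finsupp.linearCombination_single R (1 : R) _).trans ?_
  exact one_smul R _

variable [TopologicalSpace R] [DiscreteTopology R]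

/-- The coefficients of a continuous map to the Laurent series. -/
def coeffMap {S : CompHaus.{u}} (g : C(S, laurentTop R)) (k : ℤ) : LocallyConstant S R :=
  ⟨fun s => HahnSeries.coeff (show LaurentSeries R from g s) k,
    isLocallyConstant_coeff g.continuous k⟩

/-- Integration of a continuous map with values in the Laurent series. -/
def integralLaurent {S : CompHaus.{u}} (g : C(S, laurentTop R)) :
    solidPresheaf R S ⟶ (laurentCondensed.{u} R).obj where
  app T := ModuleCat.ofHom
    { toFun := fun x => (⟨fun t => HahnSeries.ofSuppBddBelow
          (fun k => integral (fun i => x.1 i t) (coeffMap g k)) (by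
            obtain ⟨n, hn⟩ := exists_coeff_bound g.continuous
            refine ⟨n, fun k hk => ?_⟩
            by_contra! h
            refine hk ?_
            have h0 : coeffMap g k = 0 := LocallyConstant.ext fun s => hn s k h
            exact (congrArg _ h0).trans
              (map_zero (solidSections_isCompatibleFamily x t).integralHom)), by
        obtain ⟨n, hn⟩ := exists_coeff_bound g.continuous
        refine continuous_laurent_of_coeff n (fun t k hk => ?_) fun k =>
          solidSections_isLocallyConstant_integral x _
        have h0 : coeffMap g k = 0 := LocallyConstant.ext fun s => hn s k hk
        exact (congrArg _ h0).trans
          (map_zero (solidSections_isCompatibleFamily x t).integralHom)⟩ :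
        C(T.unop, laurentTop R))
      map_add' := fun x y => ContinuousMap.ext fun t => HahnSeries.ext (funext fun k =>
        map_add (Finsupp.linearCombination R _) (x.1 _ t) (y.1 _ t))
      map_smul' := fun r x => ContinuousMap.ext fun t => HahnSeries.ext (funext fun k =>
        map_smul (Finsupp.linearCombination R _) r (x.1 _ t)) }
  naturality T T' f := rfl

variable (R) in
-- Surjectivity is integration of `g` coefficient by coefficient. For injectivity, a map is
-- determined on points, and each of its coefficients is integration against the corresponding
-- coefficient of its value at the Dirac section.
theorem isSolidMod_laurentCondensed : IsSolidMod.{u} R (laurentCondensed.{u} R) := by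
  refine isSolidMod_of_bijective fun S => ⟨fun φ ψ h => ?_, fun g => ?_⟩
  · have : TotallyDisconnectedSpace (Stonean.toCompHaus.obj S) :=
      inferInstanceAs (TotallyDisconnectedSpace (Stonean.toProfinite.obj S))
    refine hom_ext_onPoints (Y := laurentTop R) fun μ => ?_
    let co (k : ℤ) : LaurentSeries R →ₗ[R] R :=
      { toFun := fun f => f.coeff k
        map_add' := fun _ _ => rfl
        map_smul' := fun _ _ => rfl }
    have key (k : ℤ) (φ : solidPresheaf R (Stonean.toCompHaus.obj S) ⟶ (laurentCondensed R).obj) :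
        co k (onPoints (Y := laurentTop R) φ μ) = integral (fun i => μ.1 i PUnit.unit)
          (coeffMap (φ.app (op (Stonean.toCompHaus.obj S))
            (diracSection R (Stonean.toCompHaus.obj S))) k) := by
      refine eq_integral_of_isLocallyConstant (co k ∘ₗ onPoints (Y := laurentTop R) φ)
        (fun T x => ?_) _ (fun s => ?_) μ
      · let g : C(T, laurentTop R) := φ.app (op T) x
        have h1 := isLocallyConstant_coeff g.continuous k
        convert h1 using 2 with t
        exact congrArg (co k) (onPoints_apply (Y := laurentTop R) φ x t).symm
      · exact congrArg (co k) (onPoints_apply (Y := laurentTop R) φ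
          (diracSection R (Stonean.toCompHaus.obj S)) s).symm
    refine HahnSeries.ext (funext fun k => ?_)
    refine (key k φ).trans (Eq.trans ?_ (key k ψ).symm)
    exact congrArg (fun g => integral (fun i => μ.1 i PUnit.unit) (coeffMap g k)) h
  · refine ⟨integralLaurent g, ContinuousMap.ext fun s => HahnSeries.ext (funext fun k => ?_)⟩
    exact integral_diracSection (coeffMap g k) s

end LaurentSolid

end

/-! ### Decomposition of Laurent series by the sign of the degree -/

section

section LaurentDecomposition

variable {R : Type v} [CommRing R]

/-- Power series, as Laurent series. -/
def laurentOfNonneg : (ℕ → R) →ₗ[R] LaurentSeries R where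
  toFun a := HahnSeries.ofSuppBddBelow (fun k => if 0 ≤ k then a k.toNat else 0)
    ⟨0, fun k hk => by by_contra! h; exact hk (if_neg (by omega))⟩
  map_add' a b := by
    ext k
    change (if 0 ≤ k then (a + b) k.toNat else 0) =
      (if 0 ≤ k then a k.toNat else 0) + (if 0 ≤ k then b k.toNat else 0)
    split_ifs <;> simp
  map_smul' r a := by
    ext k
    change (if 0 ≤ k then (r • a) k.toNat else 0) = r • (if 0 ≤ k then a k.toNat else 0)
    split_ifs <;> simp

theorem laurentOfNonneg_coeff (a : ℕ → R) (k : ℤ) :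
    (laurentOfNonneg a).coeff k = if 0 ≤ k then a k.toNat else 0 := rfl

/-- Polynomials in the inverse of the variable without constant term, as Laurent series. -/
def laurentOfNeg : (ℕ →₀ R) →ₗ[R] LaurentSeries R where
  toFun a := HahnSeries.ofSuppBddBelow (fun k => if 0 ≤ k then 0 else a (-1 - k).toNat) (by
    obtain ⟨n, hn⟩ := exists_bound a
    refine ⟨-n, fun k hk => ?_⟩
    by_contra! h
    refine hk ?_
    change (if 0 ≤ k then _ else _) = _
    rw [if_neg (by omega), hn _ (by omega)])
  map_add' a b := by
    ext k
    change (if 0 ≤ k then 0 else (a + b) (-1 - k).toNat) =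
      (if 0 ≤ k then 0 else a (-1 - k).toNat) + (if 0 ≤ k then 0 else b (-1 - k).toNat)
    split_ifs <;> simp
  map_smul' r a := by
    ext k
    change (if 0 ≤ k then 0 else (r • a) (-1 - k).toNat) =
      r • (if 0 ≤ k then 0 else a (-1 - k).toNat)
    split_ifs <;> simp

theorem laurentOfNeg_coeff (a : ℕ →₀ R) (k : ℤ) :
    (laurentOfNeg a).coeff k = if 0 ≤ k then 0 else a (-1 - k).toNat := rfl

/-- The nonnegative coefficients of a Laurent series. -/
def nonnegCoeff : LaurentSeries R →ₗ[R] (ℕ → R) where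
  toFun f n := f.coeff n
  map_add' _ _ := rfl
  map_smul' _ _ := rfl

theorem nonnegCoeff_apply (f : LaurentSeries R) (n : ℕ) : nonnegCoeff f n = f.coeff n := rfl

/-- The negative coefficients of a Laurent series. -/
def negCoeff : LaurentSeries R →ₗ[R] (ℕ →₀ R) where
  toFun f := Finsupp.onFinset (Finset.range (-f.order).toNat) (fun n => f.coeff (-1 - n))
    fun n hn => by
      rw [Finset.mem_range]
      by_contra! h
      exact hn (HahnSeries.coeff_eq_zero_of_lt_order (by omega))
  map_add' _ _ := Finsupp.ext fun _ => rfl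
  map_smul' _ _ := Finsupp.ext fun _ => rfl

theorem negCoeff_apply (f : LaurentSeries R) (n : ℕ) : negCoeff f n = f.coeff (-1 - n) := rfl

theorem nonnegCoeff_laurentOfNonneg (a : ℕ → R) : nonnegCoeff (laurentOfNonneg a) = a := by
  funext n
  rw [nonnegCoeff_apply, laurentOfNonneg_coeff, if_pos (by omega), Int.toNat_natCast]

theorem negCoeff_laurentOfNonneg (a : ℕ → R) : negCoeff (laurentOfNonneg a) = 0 := by
  ext n
  rw [negCoeff_apply, laurentOfNonneg_coeff, if_neg (by omega), Finsupp.zero_apply]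

theorem nonnegCoeff_laurentOfNeg (a : ℕ →₀ R) : nonnegCoeff (laurentOfNeg a) = 0 := by
  funext n
  rw [nonnegCoeff_apply, laurentOfNeg_coeff, if_pos (by omega), Pi.zero_apply]

theorem negCoeff_laurentOfNeg (a : ℕ →₀ R) : negCoeff (laurentOfNeg a) = a := by
  ext n
  rw [negCoeff_apply, laurentOfNeg_coeff, if_neg (by omega)]
  congr 1
  omega

theorem laurentOfNonneg_add_laurentOfNeg (f : LaurentSeries R) :
    laurentOfNonneg (nonnegCoeff f) + laurentOfNeg (negCoeff f) = f := by
  ext k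
  rw [HahnSeries.coeff_add, laurentOfNonneg_coeff, laurentOfNeg_coeff, nonnegCoeff_apply,
    negCoeff_apply]
  split_ifs
  · rw [add_zero]
    congr 1
    omega
  · rw [zero_add]
    congr 1
    omega

end LaurentDecomposition

/-! ### Products and coproducts of the condensed module `R` -/

section CondensedDecomposition

variable (R : Type (u + 1)) [CommRing R]

/-- The condensed module of locally constant functions. -/
abbrev locallyConstantCondensed (M : ModuleCat.{u + 1} R) : CondensedMod.{u} R :=
  (CondensedMod.LocallyConstant.functor.{u} R).obj M

/-- Locally constant functions with finitely supported values as finite families of locally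
constant functions. -/
def locallyConstantFinsupp (S : Type*) [TopologicalSpace S] [CompactSpace S] :
    LocallyConstant S (ℕ →₀ R) →ₗ[R] (ℕ →₀ LocallyConstant S R) where
  toFun f := Finsupp.ofSupportFinite (fun n => f.map fun x => x n) (by
    -- A locally constant function on a compact space has finite range, so only finitely many
    -- coordinates occur. This is why the coproduct can be described on sections.
    refine (f.range_finite.biUnion fun x _ => x.support.finite_toSet).subset fun n hn => ?_
    by_contra h
    refine hn (LocallyConstant.ext fun s => ?_)
    by_contra h'
    exact h (Set.mem_biUnion ⟨s, rfl⟩ (Finsupp.mem_support_iff.2 h')))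
  map_add' _ _ := Finsupp.ext fun _ => rfl
  map_smul' _ _ := Finsupp.ext fun _ => rfl

variable {R}

theorem locallyConstantFinsupp_apply {S : Type*} [TopologicalSpace S] [CompactSpace S]
    (f : LocallyConstant S (ℕ →₀ R)) (n : ℕ) (s : S) :
    locallyConstantFinsupp R S f n s = f s n := rfl

/-- The inclusion of a coefficient. -/
def locallyConstantSingle (S : Type*) [TopologicalSpace S] (n : ℕ) :
    LocallyConstant S R →ₗ[R] LocallyConstant S (ℕ →₀ R) :=
  LocallyConstant.mapₗ R (Finsupp.lsingle n)

theorem sum_locallyConstantFinsupp {S : Type*} [TopologicalSpace S] [CompactSpace S]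
    (f : LocallyConstant S (ℕ →₀ R)) :
    (locallyConstantFinsupp R S f).sum (fun n g => locallyConstantSingle S n g) = f := by
  refine LocallyConstant.ext fun s => Finsupp.ext fun m => ?_
  rw [Finsupp.sum, ← LocallyConstant.coeFnAddMonoidHom_apply, map_sum, Finset.sum_apply,
    Finsupp.finsetSum_apply]
  refine (Finset.sum_eq_single m (fun n _ hn => Finsupp.single_eq_of_ne hn.symm) fun hm => ?_).trans ?_
  · have := DFunLike.congr_fun (Finsupp.notMem_support_iff.1 hm) s
    change Finsupp.single m (locallyConstantFinsupp R S f m s) m = 0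
    rw [this]
    simp
  · exact Finsupp.single_eq_same

theorem locallyConstantFinsupp_single {S : Type*} [TopologicalSpace S] [CompactSpace S]
    (n : ℕ) (g : LocallyConstant S R) :
    locallyConstantFinsupp R S (locallyConstantSingle S n g) = Finsupp.single n g := by
  classical
  refine Finsupp.ext fun m => LocallyConstant.ext fun s => ?_
  rw [locallyConstantFinsupp_apply, Finsupp.single_apply]
  change Finsupp.single n (g s) m = _
  rw [Finsupp.single_apply]
  split_ifs <;> rfl

variable (R) in
/-- The condensed module `⨁ R` as a cofan. -/
def coproductCofan : Cofan fun _ : ℕ => locallyConstantCondensed.{u} R (ModuleCat.of R R) :=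
  Cofan.mk (locallyConstantCondensed.{u} R (ModuleCat.of R (ℕ →₀ R)))
    fun n => (CondensedMod.LocallyConstant.functor.{u} R).map
      (ModuleCat.ofHom (Finsupp.lsingle n))

theorem lsum_mapRange_eq {A B M N : Type*} [AddCommGroup A] [Module R A] [AddCommGroup B]
    [Module R B] [AddCommGroup M] [Module R M] [AddCommGroup N] [Module R N]
    (p : ℕ → A →ₗ[R] M) (q : ℕ → B →ₗ[R] N) (c : A →ₗ[R] B) (w : M →ₗ[R] N)
    (h : ∀ n a, q n (c a) = w (p n a)) (x : ℕ →₀ A) :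
    Finsupp.lsum R q (Finsupp.mapRange.linearMap c x) = w (Finsupp.lsum R p x) := by
  induction x using Finsupp.induction_linear with
  | zero => simp only [map_zero]
  | add a b ha hb => simp only [map_add, ha, hb]
  | single n a =>
    rw [Finsupp.mapRange.linearMap_apply, Finsupp.mapRange_single, Finsupp.lsum_single,
      Finsupp.lsum_single, h]

/-- The action of a map out of the condensed module `R` on sections. -/
def locallyConstantSection {M : ModuleCat.{u + 1} R} {W : CondensedMod.{u} R}
    (d : locallyConstantCondensed.{u} R M ⟶ W) (S : CompHaus.{u}ᵒᵖ) :
    LocallyConstant S.unop M →ₗ[R] W.obj.obj S :=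
  (d.hom.app S).hom

/-- The map out of the sections of `⨁ R` given by a family of maps. -/
def coproductDescSection {W : CondensedMod.{u} R}
    (d : ℕ → (locallyConstantCondensed.{u} R (ModuleCat.of R R) ⟶ W)) (S : CompHaus.{u}ᵒᵖ) :
    LocallyConstant S.unop (ℕ →₀ R) →ₗ[R] W.obj.obj S :=
  Finsupp.lsum R (fun n => locallyConstantSection (d n) S) ∘ₗ locallyConstantFinsupp R S.unop

theorem coproductDescSection_single {W : CondensedMod.{u} R}
    (d : ℕ → (locallyConstantCondensed.{u} R (ModuleCat.of R R) ⟶ W)) (S : CompHaus.{u}ᵒᵖ)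
    (n : ℕ) (g : LocallyConstant S.unop R) :
    coproductDescSection d S (locallyConstantSingle S.unop n g) =
      locallyConstantSection (d n) S g := by
  rw [coproductDescSection, LinearMap.comp_apply, locallyConstantFinsupp_single,
    Finsupp.lsum_single]

theorem eq_coproductDescSection {W : CondensedMod.{u} R}
    (d : ℕ → (locallyConstantCondensed.{u} R (ModuleCat.of R R) ⟶ W)) (S : CompHaus.{u}ᵒᵖ)
    (m : LocallyConstant S.unop (ℕ →₀ R) →ₗ[R] W.obj.obj S)
    (h : ∀ n g, m (locallyConstantSingle S.unop n g) = locallyConstantSection (d n) S g) :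
    m = coproductDescSection d S := by
  refine LinearMap.ext fun g => ?_
  conv_lhs => rw [← sum_locallyConstantFinsupp g]
  rw [coproductDescSection, LinearMap.comp_apply, Finsupp.lsum_apply, Finsupp.sum, Finsupp.sum,
    map_sum]
  exact Finset.sum_congr rfl fun n _ => h n _

/-- The map out of the condensed module `⨁ R` given by a family of maps. -/
def coproductDesc {W : CondensedMod.{u} R}
    (d : ℕ → (locallyConstantCondensed.{u} R (ModuleCat.of R R) ⟶ W)) :
    locallyConstantCondensed.{u} R (ModuleCat.of R (ℕ →₀ R)) ⟶ W :=
  ObjectProperty.homMk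
    { app := fun S => ModuleCat.ofHom (coproductDescSection d S)
      naturality := fun S T f => by
        ext g
        obtain ⟨g, rfl⟩ : ∃ g' : LocallyConstant S.unop (ℕ →₀ R), g' = g := ⟨g, rfl⟩
        have h1 : locallyConstantFinsupp R T.unop (g.comap f.unop.hom.hom) =
            Finsupp.mapRange.linearMap (LocallyConstant.comapₗ R f.unop.hom.hom)
              (locallyConstantFinsupp R S.unop g) := Finsupp.ext fun n => rfl
        have h2 : coproductDescSection d T (g.comap f.unop.hom.hom) =
            (W.obj.map f).hom (coproductDescSection d S g) := by
          rw [coproductDescSection, coproductDescSection, LinearMap.comp_apply,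
            LinearMap.comp_apply, h1]
          exact lsum_mapRange_eq _ _ _ _
            (fun n a => NatTrans.naturality_apply (d n).hom f a) _
        exact h2 }

variable (R) in
/-- The condensed module `⨁ R` is a coproduct. -/
def coproductIsColimit : IsColimit (coproductCofan.{u} R) :=
  Cofan.IsColimit.mk _ (fun s => coproductDesc s.inj)
    (fun s n => by
      ext S g
      exact coproductDescSection_single s.inj S n g)
    (fun s m hm => by
      ext S g
      exact DFunLike.congr_fun (eq_coproductDescSection s.inj S (locallyConstantSection m S)
        fun n g => congrArg (fun f => f.hom.app S g) (hm n)) g)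

variable [TopologicalSpace R] [DiscreteTopology R]

variable (R) in
/-- The topological module `∏ R`. -/
def productTop : TopModuleCat.{u + 1} R := TopModuleCat.of R (ℕ → R)

variable (R) in
/-- The condensed module `∏ R` as a fan. -/
def productFan : Fan fun _ : ℕ => locallyConstantCondensed.{u} R (ModuleCat.of R R) :=
  Fan.mk ((TopModuleCat.toCondensed.{u} R).obj (productTop.{u} R)) fun n => ObjectProperty.homMk
    { app := fun S => ModuleCat.ofHom
        { toFun := fun g : C(S.unop, ℕ → R) => (⟨fun s => g s n,
            (IsLocallyConstant.iff_continuous _).2 ((continuous_apply n).comp g.continuous)⟩ :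
              LocallyConstant S.unop R)
          map_add' := fun _ _ => rfl
          map_smul' := fun _ _ => rfl } }

variable (R) in
/-- The condensed module `∏ R` is a product. -/
def productIsLimit : IsLimit (productFan.{u} R) :=
  Fan.IsLimit.mk _ (fun s => ObjectProperty.homMk
    { app := fun S => ModuleCat.ofHom
        { toFun := fun x => (⟨fun t n => DFunLike.coe (F := LocallyConstant S.unop R)
              ((s.proj n).hom.app S x) t, continuous_pi fun n =>
                (LocallyConstant.continuous (Y := R) ((s.proj n).hom.app S x))⟩ : C(S.unop, ℕ → R))
          map_add' := fun x y => ContinuousMap.ext fun t => funext fun n =>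
            DFunLike.congr_fun (F := LocallyConstant S.unop R)
              (map_add ((s.proj n).hom.app S).hom x y) t
          map_smul' := fun r x => ContinuousMap.ext fun t => funext fun n =>
            DFunLike.congr_fun (F := LocallyConstant S.unop R)
              (map_smul ((s.proj n).hom.app S).hom r x) t }
      naturality := fun S T f => by
        ext x
        refine ContinuousMap.ext fun t => funext fun n => ?_
        exact DFunLike.congr_fun (F := LocallyConstant T.unop R)
          (NatTrans.naturality_apply (s.proj n).hom f x) t })
    (fun s n => by
      ext S x
      exact LocallyConstant.ext fun t => rfl)
    (fun s m hm => by
      ext S x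
      refine ContinuousMap.ext fun t => funext fun n => ?_
      have := hm n
      exact DFunLike.congr_fun (F := LocallyConstant S.unop R)
        (congrArg (fun f => f.hom.app S x) this) t)

variable (R) in
/-- The decomposition of the condensed module of Laurent series. -/
def laurentBicone : BinaryBicone (productFan.{u} R).pt (coproductCofan.{u} R).pt where
  pt := laurentCondensed.{u} R
  fst := ObjectProperty.homMk
    { app := fun S => ModuleCat.ofHom
        { toFun := fun g : C(S.unop, laurentTop R) => (⟨fun s => nonnegCoeff (R := R) (g s),
            continuous_pi fun n => (isLocallyConstant_coeff g.continuous n).continuous⟩ :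
              C(S.unop, ℕ → R))
          map_add' := fun _ _ => rfl
          map_smul' := fun _ _ => rfl } }
  snd := ObjectProperty.homMk
    { app := fun S => ModuleCat.ofHom
        { toFun := fun g : C(S.unop, laurentTop R) => (⟨fun s => negCoeff (R := R) (g s), by
            refine (IsLocallyConstant.iff_eventually_eq _).2 fun s => ?_
            -- Series congruent modulo the open submodule `R⟦t⟧` have the same negative part, so the
            -- negative part is locally constant.
            refine (eventually_sub_mem_laurentGE g.continuous 0 s).mono fun s' hs' => ?_
            refine Finsupp.ext fun n => ?_
            have := hs' (-1 - n) (by omega)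
            exact sub_eq_zero.1 this⟩ : LocallyConstant S.unop (ℕ →₀ R))
          map_add' := fun _ _ => LocallyConstant.ext fun _ => map_add negCoeff _ _
          map_smul' := fun _ _ => LocallyConstant.ext fun _ => map_smul negCoeff _ _ } }
  inl := ObjectProperty.homMk
    { app := fun S => ModuleCat.ofHom
        { toFun := fun g : C(S.unop, ℕ → R) => (⟨fun s => laurentOfNonneg (g s), by
            refine continuous_laurent_of_coeff 0 (fun s k hk => ?_) fun k => ?_
            · rw [laurentOfNonneg_coeff, if_neg (by omega)]
            · simp only [laurentOfNonneg_coeff]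
              split_ifs
              · exact (IsLocallyConstant.iff_continuous _).2
                  ((continuous_apply k.toNat).comp g.continuous)
              · exact IsLocallyConstant.const 0⟩ : C(S.unop, laurentTop R))
          map_add' := fun _ _ => ContinuousMap.ext fun _ => map_add laurentOfNonneg _ _
          map_smul' := fun _ _ => ContinuousMap.ext fun _ => map_smul laurentOfNonneg _ _ } }
  inr := ObjectProperty.homMk
    { app := fun S => ModuleCat.ofHom
        { toFun := fun g : LocallyConstant S.unop (ℕ →₀ R) => (⟨fun s => laurentOfNeg (g s),
            IsLocallyConstant.continuous (Y := laurentTop R)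
              (g.isLocallyConstant.comp laurentOfNeg)⟩ : C(S.unop, laurentTop R))
          map_add' := fun _ _ => ContinuousMap.ext fun _ => map_add laurentOfNeg _ _
          map_smul' := fun _ _ => ContinuousMap.ext fun _ => map_smul laurentOfNeg _ _ } }
  inl_fst := by
    ext S g
    exact ContinuousMap.ext fun s => nonnegCoeff_laurentOfNonneg _
  inl_snd := by
    ext S g
    exact LocallyConstant.ext fun s => negCoeff_laurentOfNonneg _
  inr_fst := by
    ext S g
    exact ContinuousMap.ext fun s =>
      nonnegCoeff_laurentOfNeg (DFunLike.coe (F := LocallyConstant S.unop (ℕ →₀ R)) g s)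
  inr_snd := by
    ext S g
    exact LocallyConstant.ext fun s =>
      negCoeff_laurentOfNeg (DFunLike.coe (F := LocallyConstant S.unop (ℕ →₀ R)) g s)

variable (R) in
theorem nonempty_laurentCondensed_iso : Nonempty (laurentCondensed.{u} R ≅
    (∏ᶜ fun _ : ℕ => unitCondensed.{u} R) ⊞ (∐ fun _ : ℕ => unitCondensed.{u} R)) := by
  have hb : (laurentBicone.{u} R).IsBilimit := isBinaryBilimitOfTotal _ (by
    ext S g
    exact ContinuousMap.ext fun s => laurentOfNonneg_add_laurentOfNeg _)
  let e : locallyConstantCondensed.{u} R (ModuleCat.of R R) ≅ unitCondensed.{u} R :=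
    (CondensedMod.LocallyConstant.functorIsoDiscrete.{u} R).app (ModuleCat.of R R)
  exact ⟨biprod.uniqueUpToIso _ _ hb ≪≫ biprod.mapIso
    ((productIsLimit.{u} R).conePointUniqueUpToIso (limit.isLimit _) ≪≫ Pi.mapIso fun _ => e)
    ((coproductIsColimit.{u} R).coconePointUniqueUpToIso (colimit.isColimit _) ≪≫
      Sigma.mapIso fun _ => e)⟩

end CondensedDecomposition

end

/-! ### Retracts, direct summands and the essential image -/

section

section Retracts

variable {C : Type*} [Category C]

/-- Two retracts with the same idempotent are isomorphic. -/
def CategoryTheory.Retract.isoOfIdempotentEq {X X' Y : C} (h : Retract X Y) (h' : Retract X' Y)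
    (e : h.r ≫ h.i = h'.r ≫ h'.i) : X ≅ X' where
  hom := h.i ≫ h'.r
  inv := h'.i ≫ h.r
  hom_inv_id := by
    rw [Category.assoc, ← Category.assoc h'.r, ← e, Category.assoc, h.retract, Category.comp_id,
      h.retract]
  inv_hom_id := by
    rw [Category.assoc, ← Category.assoc h.r, e, Category.assoc, h'.retract, Category.comp_id,
      h'.retract]

theorem CategoryTheory.ObjectProperty.isIdempotentComplete_fullSubcategory [IsIdempotentComplete C]
    (P : ObjectProperty C) [P.IsStableUnderRetracts] :
    IsIdempotentComplete P.FullSubcategory where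
  idempotents_split X p hp := by
    obtain ⟨Y, i, e, h1, h2⟩ := IsIdempotentComplete.idempotents_split X.obj p.hom
      (congrArg (fun f => f.hom) hp)
    refine ⟨⟨Y, P.prop_of_retract ⟨i, e, h1⟩ X.property⟩, ObjectProperty.homMk i,
      ObjectProperty.homMk e, ?_, ?_⟩
    · ext
      exact h1
    · ext
      exact h2

/-- The complement of a retract is obtained by splitting the complementary idempotent `1 - r ≫ i`.
-/
theorem isDirectSummand_iff_nonempty_retract [Preadditive C] [IsIdempotentComplete C] {X Y : C} :
    IsDirectSummand X Y ↔ Nonempty (Retract X Y) := by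
  constructor
  · rintro ⟨Z, b, -, ⟨e⟩⟩
    exact ⟨(Retract.mk b.inl b.fst b.inl_fst).trans (Retract.ofIso e)⟩
  · rintro ⟨h⟩
    have hp : (h.r ≫ h.i) ≫ h.r ≫ h.i = h.r ≫ h.i := by
      rw [Category.assoc, ← Category.assoc h.i, h.retract, Category.id_comp]
    obtain ⟨Z, i, e, h1, h2⟩ := IsIdempotentComplete.idempotents_split Y _
      (Idempotents.idem_of_id_sub_idem _ hp)
    have h3 : h.i ≫ e = 0 := by
      rw [← Category.comp_id e, ← h1, ← Category.assoc e, h2, Preadditive.sub_comp,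
        Category.id_comp, Preadditive.comp_sub, Category.assoc, ← Category.assoc h.i h.r,
        h.retract, Category.id_comp, sub_self]
    have h4 : i ≫ h.r = 0 := by
      rw [← Category.id_comp i, ← h1, Category.assoc i, h2, Preadditive.comp_sub,
        Category.comp_id, Preadditive.sub_comp, Category.assoc, Category.assoc, h.retract,
        Category.comp_id, sub_self]
    let b : BinaryBicone X Z :=
      { pt := Y
        fst := h.r
        snd := e
        inl := h.i
        inr := i
        inl_fst := h.retract
        inl_snd := h3
        inr_fst := h4
        inr_snd := h1 }
    exact ⟨Z, b, ⟨isBinaryBilimitOfTotal b (by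
      change h.r ≫ h.i + e ≫ i = 𝟙 Y
      rw [h2, add_sub_cancel])⟩, ⟨Iso.refl _⟩⟩

end Retracts

variable {R : Type (u + 1)} [CommRing R]

instance : (IsSolidMod.{u} R).IsStableUnderRetracts where
  -- Both `Hom(R_■[S], M)` and `M(S)` are functorial in `M`, and a retract of a bijection is a
  -- bijection.
  of_retract {M N} h hN S := by
    refine ⟨fun f g hfg => ?_, fun x => ?_⟩
    · have h1 : f ≫ h.i = g ≫ h.i := (hN S).1 (congrArg (h.i.hom.app _) hfg)
      rw [← Category.comp_id f, ← h.retract, ← Category.assoc, h1, Category.assoc, h.retract,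
        Category.comp_id]
    · obtain ⟨f, hf⟩ := (hN S).2 (h.i.hom.app _ x)
      refine ⟨f ≫ h.r, (congrArg (h.r.hom.app _) hf).trans ?_⟩
      exact congrArg (fun φ => φ.hom.app _ x) h.retract

instance : IsIdempotentComplete (SolidMod.{u} R) :=
  (IsSolidMod.{u} R).isIdempotentComplete_fullSubcategory

namespace TopModuleCat

theorem toCondensed_map_injective [TopologicalSpace R] {X Y : TopModuleCat.{u + 1} R} {φ ψ : X ⟶ Y}
    (h : (toCondensed.{u} R).map φ = (toCondensed.{u} R).map ψ) : φ = ψ := by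
  ext x
  exact DFunLike.congr_fun (F := C(point.{u}, Y)) (congrArg (fun f => f.hom.app (op point.{u})
    (ContinuousMap.const point.{u} x : C(point.{u}, X))) h) (default : PUnit)

end TopModuleCat

variable [TopologicalSpace R] [DiscreteTopology R]

theorem laurentTop_hom_exists_le (f : laurentTop R ⟶ laurentTop R) (n : ℤ) :
    ∃ m, laurentGE R m ≤ (laurentGE R n).comap f.hom.toLinearMap := by
  obtain ⟨V, hV, h⟩ := linTopology_exists_le (O := f.hom ⁻¹' (laurentGE R n : Set (LaurentSeries R)))
    (x := 0)
    laurentBasis_nonempty laurentBasis_directed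
    ((linTopology_isOpen_of_mem (laurentGE_mem R n)).preimage f.hom.continuous)
    ((laurentGE R n).comap f.hom.toLinearMap).zero_mem
  obtain ⟨m, rfl⟩ := mem_laurentBasis hV
  exact ⟨m, fun y hy => h y ((sub_zero y).symm ▸ hy)⟩

/-- The condensed realization of the Tate module of Laurent series. -/
def realizationLaurentCondensedIso :
    (TopModuleCat.toCondensed.{u} R).obj ((tateRealization R).obj (laurentTate R)) ≅
      laurentCondensed.{u} R :=
  (TopModuleCat.toCondensed.{u} R).mapIso (realizationLaurentIso R)

theorem isSolidMod_tateToCondensed (T : TateCat R) :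
    IsSolidMod.{u} R ((tateToCondensed.{u} R).obj T) := by
  obtain ⟨E, hE, ⟨h⟩⟩ := T.property
  obtain ⟨h'⟩ := hE.nonempty_retract
  exact ObjectProperty.prop_of_retract _
    (((h.trans h').map (tateRealization R ⋙ TopModuleCat.toCondensed.{u} R)).trans
      (Retract.ofIso realizationLaurentCondensedIso)) (isSolidMod_laurentCondensed R)

theorem nonempty_retract_of_essImage {M : SolidMod.{u} R}
    (hM : (tateToSolid.{u} R isSolidMod_tateToCondensed).essImage M) :
    Nonempty (Retract M ⟨laurentCondensed.{u} R, isSolidMod_laurentCondensed R⟩) := by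
  obtain ⟨T, ⟨e⟩⟩ := hM
  obtain ⟨E, hE, ⟨h⟩⟩ := T.property
  obtain ⟨h'⟩ := hE.nonempty_retract
  have h1 := ((h.trans h').map (tateRealization R ⋙ TopModuleCat.toCondensed.{u} R)).trans
      (Retract.ofIso realizationLaurentCondensedIso)
  refine ⟨(Retract.ofIso e.symm).trans
    ⟨ObjectProperty.homMk h1.i, ObjectProperty.homMk h1.r, ?_⟩⟩
  ext1
  exact h1.retract

/-- An idempotent of the condensed module of Laurent series comes from an idempotent of the
corresponding Tate module. -/
theorem exists_idempotent_laurentTate (p : laurentCondensed.{u} R ⟶ laurentCondensed.{u} R)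
    (hp : p ≫ p = p) :
    ∃ φ : laurentTate R ⟶ laurentTate R, φ ≫ φ = φ ∧
      (TopModuleCat.toCondensed.{u} R).map ((tateRealization R).map φ) ≫
        realizationLaurentCondensedIso.hom = realizationLaurentCondensedIso.hom ≫ p := by
  obtain ⟨f, rfl⟩ := TopModuleCat.exists_toCondensed_map_eq (X := laurentTop R)
    (Y := laurentTop R) p
  have hf : f ≫ f = f := TopModuleCat.toCondensed_map_injective 
    (((TopModuleCat.toCondensed.{u} R).map_comp f f).trans hp)
  obtain ⟨φ, hφ⟩ := exists_laurentTate_hom (f := f.hom.toLinearMap) (laurentTop_hom_exists_le f)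
  -- `φ` inherits idempotency from `f`, because morphisms of the Tate object are detected on Laurent
  -- series over `R`.
  refine ⟨φ, laurentTate_hom_ext fun x => laurentEquiv.injective ?_, ?_⟩
  · refine (hφ _).trans ((congrArg f.hom (hφ x)).trans ?_)
    refine Eq.trans ?_ (hφ x).symm
    exact congrArg (fun g => g.hom (laurentEquiv x)) hf
  · have h : (tateRealization R).map φ ≫ (realizationLaurentIso R).hom =
        (realizationLaurentIso R).hom ≫ f := by
      ext x
      exact hφ x
    exact ((TopModuleCat.toCondensed.{u} R).map_comp _ _).symm.trans
      ((congrArg (TopModuleCat.toCondensed.{u} R).map h).trans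
        ((TopModuleCat.toCondensed.{u} R).map_comp _ _))

/-- The idempotent of `R((t))` with image `M` lifts to the Tate object and splits there, by
idempotent completeness of presheaves. The realization of its image and `M` are retracts with the
same idempotent, hence isomorphic. -/
theorem essImage_of_nonempty_retract {M : SolidMod.{u} R}
    (h : Retract M ⟨laurentCondensed.{u} R, isSolidMod_laurentCondensed R⟩) :
    (tateToSolid.{u} R isSolidMod_tateToCondensed).essImage M := by
  let h' : Retract M.obj (laurentCondensed.{u} R) := h.map (ObjectProperty.ι _)
  obtain ⟨φ, hφ, hφ'⟩ := exists_idempotent_laurentTate (h'.r ≫ h'.i) (by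
    rw [Category.assoc, ← Category.assoc h'.i, h'.retract, Category.id_comp])
  obtain ⟨T, i, e, h1, h2⟩ := IsIdempotentComplete.idempotents_split _ φ hφ
  let ρ : Retract T (laurentTate R) := ⟨i, e, h1⟩
  let ρ' := (ρ.map (tateRealization R ⋙ TopModuleCat.toCondensed.{u} R)).trans
    (Retract.ofIso realizationLaurentCondensedIso)
  have h3 : ρ'.r ≫ ρ'.i = h'.r ≫ h'.i := by
    have h4 : (tateRealization R ⋙ TopModuleCat.toCondensed.{u} R).map e ≫
        (tateRealization R ⋙ TopModuleCat.toCondensed.{u} R).map i =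
          (tateRealization R ⋙ TopModuleCat.toCondensed.{u} R).map φ := by
      rw [← Functor.map_comp, h2]
    change (realizationLaurentCondensedIso.inv ≫
      (tateRealization R ⋙ TopModuleCat.toCondensed.{u} R).map e) ≫
      (tateRealization R ⋙ TopModuleCat.toCondensed.{u} R).map i ≫
        realizationLaurentCondensedIso.hom = _
    rw [Category.assoc, Iso.inv_comp_eq, ← hφ', ← Category.assoc, h4]
    rfl
  exact ⟨⟨T, laurentTate R, isElementaryTate_laurentTate R, ⟨ρ⟩⟩,
    ⟨ObjectProperty.isoMk _ (ρ'.isoOfIdempotentEq h' h3)⟩⟩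

end

theorem proposition2p1 (R : Type (u + 1)) [CommRing R] [TopologicalSpace R] [DiscreteTopology R] :
    ∃ (hTS : ∀ T : TateCat R, IsSolidMod.{u} R ((tateToCondensed.{u} R).obj T))
      (hL : IsSolidMod.{u} R (laurentCondensed.{u} R)),
      Nonempty (laurentCondensed.{u} R ≅
        (∏ᶜ fun _ : ℕ => unitCondensed.{u} R) ⊞ (∐ fun _ : ℕ => unitCondensed.{u} R)) ∧
      ∀ M : SolidMod.{u} R,
        (tateToSolid.{u} R hTS).essImage M ↔ IsDirectSummand M ⟨laurentCondensed.{u} R, hL⟩ :=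
  ⟨isSolidMod_tateToCondensed, isSolidMod_laurentCondensed R, nonempty_laurentCondensed_iso R,
    fun _ => ⟨fun hM => isDirectSummand_iff_nonempty_retract.2 (nonempty_retract_of_essImage hM),
      fun hM => essImage_of_nonempty_retract (isDirectSummand_iff_nonempty_retract.1 hM).some⟩⟩

end
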